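/- Let $\Bbbk$ be a field, $V$ a finite-dimensional $\Bbbk$-vector space with basis $(v_i)$, $c$ an invertible endomorphism of $V\otimes V$ and $t$ an endomorphism of $V\otimes V$. Write $f_{12}=f\otimes\mathrm{Id}$, $f_{23}=\mathrm{Id}\otimes f$ on $V^{\otimes 3}$ and $f(v_i\otimes v_j)=\sum_{k,\ell} f_{ij}^{k\ell}\,v_k\otimes v_\ell$ for $f\in\mathrm{End}(V\otimes V)$. Assume that $(V,c,t)$ is an infinitesimally braided vector space, i.e. that on $V^{\otimes 3}$ $$c_{12}c_{23}c_{12}=c_{23}c_{12}c_{23},\qquad c_{23}t_{12}c_{23}^{-1}=c_{12}^{-1}t_{23}c_{12}=c_{23}^{-1}t_{12}c_{23}=c_{12}t_{23}c_{12}^{-1},$$ $$[\,t_{12}+c_{12}t_{23}c_{12}^{-1},\,t_{23}\,]=0,\qquad [\,t_{23}+c_{23}t_{12}c_{23}^{-1},\,t_{12}\,]=0 .$$ Let $F$ be the free algebra on indeterminates $T_i^j$, a bialgebra with $\Delta(T_i^j)=\sum_k T_i^k\otimes T_k^j$ and $\varepsilon(T_i^j)=\delta_i^j$. Let $A(c)=F/I(c)$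 with $I(c)$ the two-sided ideal generated by all $\sum_{m,n} \big(c_{ij}^{mn}T_m^kT_n^\ell-T_i^mT_j^n c_{mn}^{k\ell}\big)$, and let $A(c,t)=A(c)/I(t)$ with $I(t)$ the two-sided ideal of $A(c)$ generated by all $\sum_{m,n}\big(t_{ij}^{mn}T_m^kT_n^\ell-T_i^mT_j^n t_{mn}^{k\ell}\big)$; both are quotient bialgebras. A coquasitriangular structure on a bialgebra $H$ is a convolution-invertible linear map $\mathcal R\colon H\otimes H\to\Bbbk$ such that, for all $a,b,c\in H$ (Sweedler notation), $\mathcal R(a_1\otimes b_1)a_2b_2=b_1a_1\mathcal R(a_2\otimes b_2)$, $\mathcal R(a\otimes bc)=\mathcal R(a_1\otimes c)\mathcal R(a_2\otimes b)$ and $\mathcal R(ab\otimes c)=\mathcal R(a\otimes c_1)\mathcal R(b\otimes c_2)$. An infinitesimal $\mathcal R$-form on $(H,\mathcal R)$ is a linear map $\chi\colon H\otimes H\to\Bbbk$ such that, for all $a,b,c\in H$, $$\chi(a_1\otimes b_1)a_2b_2=a_1b_1\chi(a_2\otimes b_2),$$ $$\chi(a\otimes bc)=\chi(a\otimes b)\varepsilon(c)+\mathcal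 R^{-1}(a_1\otimes b_1)\chi(a_2\otimes c)\mathcal R(a_3\otimes b_2),$$ $$\chi(ab\otimes c)=\varepsilon(a)\chi(b\otimes c)+\mathcal R^{-1}(b_1\otimes c_1)\chi(a\otimes c_2)\mathcal R(b_2\otimes c_3).$$ Then there is a unique coquasitriangular structure $\mathcal R$ on $A(c)$ with $\mathcal R(T_i^k\otimes T_j^\ell)=c_{ji}^{k\ell}$ for all $i,j,k,\ell$ (the FRT structure); it descends to a coquasitriangular structure, again denoted $\mathcal R$, on the quotient $A(c,t)$; and there is a unique infinitesimal $\mathcal R$-form $\chi$ on $(A(c,t),\mathcal R)$ such that $\chi(T_i^k\otimes T_j^\ell)=t_{ij}^{k\ell}$ for all $i,j,k,\ell$. -/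

import Mathlib

open scoped TensorProduct
open WithConv

noncomputable section

namespace InfFRT

/-! ### Coquasitriangular bialgebras and infinitesimal `R`-forms -/

section Forms

variable {k H : Type*} [Field k] [Ring H] [Bialgebra k H]

/-- The convolution algebra `Hom(H ⊗ H, k)` of bilinear forms on `H`. -/
abbrev ConvForm (k H : Type*) [Field k] [Ring H] [Bialgebra k H] : Type _ :=
  WithConv (H ⊗[k] H →ₗ[k] k)

/-- `f₁₂ = f ⊗ ε`, i.e. `f₁₂(a ⊗ b ⊗ c) = f(a ⊗ b) ε(c)`. -/
def form12 (f : ConvForm k H) : WithConv ((H ⊗[k] H) ⊗[k] H →ₗ[k] k) :=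
  toConv (LinearMap.mul' k k ∘ₗ TensorProduct.map f.ofConv Coalgebra.counit)

/-- `f₂₃ = ε ⊗ f`, i.e. `f₂₃(a ⊗ b ⊗ c) = ε(a) f(b ⊗ c)`. -/
def form23 (f : ConvForm k H) : WithConv ((H ⊗[k] H) ⊗[k] H →ₗ[k] k) :=
  toConv (LinearMap.mul' k k ∘ₗ TensorProduct.map Coalgebra.counit f.ofConv ∘ₗ
    (TensorProduct.assoc k H H H).toLinearMap)

/-- `f₁₃ = (ε ⊗ f)(τ ⊗ Id)`, i.e. `f₁₃(a ⊗ b ⊗ c) = ε(b) f(a ⊗ c)`. -/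
def form13 (f : ConvForm k H) : WithConv ((H ⊗[k] H) ⊗[k] H →ₗ[k] k) :=
  toConv ((form23 f).ofConv ∘ₗ
    TensorProduct.map (TensorProduct.comm k H H).toLinearMap LinearMap.id)

/-- `f(Id ⊗ m)`, i.e. `a ⊗ b ⊗ c ↦ f(a ⊗ bc)`. -/
def formMulRight (f : ConvForm k H) : WithConv ((H ⊗[k] H) ⊗[k] H →ₗ[k] k) :=
  toConv (f.ofConv ∘ₗ TensorProduct.map LinearMap.id (LinearMap.mul' k H) ∘ₗ
    (TensorProduct.assoc k H H H).toLinearMap)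

/-- `f(m ⊗ Id)`, i.e. `a ⊗ b ⊗ c ↦ f(ab ⊗ c)`. -/
def formMulLeft (f : ConvForm k H) : WithConv ((H ⊗[k] H) ⊗[k] H →ₗ[k] k) :=
  toConv (f.ofConv ∘ₗ TensorProduct.map (LinearMap.mul' k H) LinearMap.id)

/-- The form `f` composed with the unit of `H`, as an element of the convolution algebra
`Hom(H ⊗ H, H)`. -/
def unitForm (f : ConvForm k H) : WithConv (H ⊗[k] H →ₗ[k] H) :=
  toConv (Algebra.linearMap k H ∘ₗ f.ofConv)

variable (k H) in
/-- The multiplication of `H`, as an element of the convolution algebra `Hom(H ⊗ H, H)`. -/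
def convMult : WithConv (H ⊗[k] H →ₗ[k] H) := toConv (LinearMap.mul' k H)

variable (k H) in
/-- The opposite multiplication `a ⊗ b ↦ ba`. -/
def convMultOp : WithConv (H ⊗[k] H →ₗ[k] H) :=
  toConv (LinearMap.mul' k H ∘ₗ (TensorProduct.comm k H H).toLinearMap)

/-- A convolution-invertible form `R` is a coquasitriangular structure on `H`. -/
structure IsCoquasitriangular (R : (ConvForm k H)ˣ) : Prop where
  /-- `R(a₁ ⊗ b₁) a₂ b₂ = b₁ a₁ R(a₂ ⊗ b₂)` -/
  quasi_comm : unitForm (R : ConvForm k H) * convMult k H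
    = convMultOp k H * unitForm (R : ConvForm k H)
  /-- `R(a ⊗ bc) = R(a₁ ⊗ c) R(a₂ ⊗ b)` -/
  mul_right : formMulRight (R : ConvForm k H)
    = form13 (R : ConvForm k H) * form12 (R : ConvForm k H)
  /-- `R(ab ⊗ c) = R(a ⊗ c₁) R(b ⊗ c₂)` -/
  mul_left : formMulLeft (R : ConvForm k H)
    = form13 (R : ConvForm k H) * form23 (R : ConvForm k H)

/-- `χ` is an infinitesimal `R`-form on `(H, R)`. -/
structure IsInfinitesimalRForm (R : (ConvForm k H)ˣ) (χ : ConvForm k H) : Prop where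
  /-- `χ(a₁ ⊗ b₁) a₂ b₂ = a₁ b₁ χ(a₂ ⊗ b₂)` -/
  central : unitForm χ * convMult k H = convMult k H * unitForm χ
  /-- `χ(a ⊗ bc) = χ(a ⊗ b) ε(c) + R⁻¹(a₁ ⊗ b₁) χ(a₂ ⊗ c) R(a₃ ⊗ b₂)` -/
  mul_right : formMulRight χ = form12 χ +
    form12 ((R⁻¹ : (ConvForm k H)ˣ) : ConvForm k H) * form13 χ * form12 (R : ConvForm k H)
  /-- `χ(ab ⊗ c) = ε(a) χ(b ⊗ c) + R⁻¹(b₁ ⊗ c₁) χ(a ⊗ c₂) R(b₂ ⊗ c₃)` -/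
  mul_left : formMulLeft χ = form23 χ +
    form23 ((R⁻¹ : (ConvForm k H)ˣ) : ConvForm k H) * form13 χ * form23 (R : ConvForm k H)

end Forms

/-! ### Infinitesimally braided vector spaces -/

section Braided

variable {k V : Type*} [Field k] [AddCommGroup V] [Module k V]

/-- `f₁₂ = f ⊗ Id` on `V ⊗ V ⊗ V`. -/
def leg12 (f : Module.End k (V ⊗[k] V)) : Module.End k ((V ⊗[k] V) ⊗[k] V) :=
  TensorProduct.map f LinearMap.id

/-- `f₂₃ = Id ⊗ f` on `V ⊗ V ⊗ V`. -/
def leg23 (f : Module.End k (V ⊗[k] V)) : Module.End k ((V ⊗[k] V) ⊗[k] V) :=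
  (TensorProduct.assoc k V V V).symm.toLinearMap ∘ₗ TensorProduct.map LinearMap.id f ∘ₗ
    (TensorProduct.assoc k V V V).toLinearMap

/-- `(V, c)` is a braided vector space. -/
def IsBraided (c : (V ⊗[k] V) ≃ₗ[k] (V ⊗[k] V)) : Prop :=
  leg12 c.toLinearMap * leg23 c.toLinearMap * leg12 c.toLinearMap =
    leg23 c.toLinearMap * leg12 c.toLinearMap * leg23 c.toLinearMap

/-- `(V, c, t)` is an infinitesimally braided vector space. -/
structure IsInfinitesimallyBraided (c : (V ⊗[k] V) ≃ₗ[k] (V ⊗[k] V))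
    (t : Module.End k (V ⊗[k] V)) : Prop where
  braid : IsBraided c
  /-- `c₂₃ t₁₂ c₂₃⁻¹ = c₁₂⁻¹ t₂₃ c₁₂` -/
  conj₁ : leg23 c.toLinearMap * leg12 t * leg23 c.symm.toLinearMap =
    leg12 c.symm.toLinearMap * leg23 t * leg12 c.toLinearMap
  /-- `c₁₂⁻¹ t₂₃ c₁₂ = c₂₃⁻¹ t₁₂ c₂₃` -/
  conj₂ : leg12 c.symm.toLinearMap * leg23 t * leg12 c.toLinearMap =
    leg23 c.symm.toLinearMap * leg12 t * leg23 c.toLinearMap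
  /-- `c₂₃⁻¹ t₁₂ c₂₃ = c₁₂ t₂₃ c₁₂⁻¹` -/
  conj₃ : leg23 c.symm.toLinearMap * leg12 t * leg23 c.toLinearMap =
    leg12 c.toLinearMap * leg23 t * leg12 c.symm.toLinearMap
  /-- `t₁₂ t₂₃ + c₁₂ t₂₃ c₁₂⁻¹ t₂₃ = t₂₃ t₁₂ + t₂₃ c₁₂ t₂₃ c₁₂⁻¹` -/
  comm₁ : leg12 t * leg23 t +
      leg12 c.toLinearMap * leg23 t * leg12 c.symm.toLinearMap * leg23 t =
    leg23 t * leg12 t +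
      leg23 t * leg12 c.toLinearMap * leg23 t * leg12 c.symm.toLinearMap
  /-- `t₂₃ t₁₂ + c₂₃ t₁₂ c₂₃⁻¹ t₁₂ = t₁₂ t₂₃ + t₁₂ c₂₃ t₁₂ c₂₃⁻¹` -/
  comm₂ : leg23 t * leg12 t +
      leg23 c.toLinearMap * leg12 t * leg23 c.symm.toLinearMap * leg12 t =
    leg12 t * leg23 t +
      leg12 t * leg23 c.toLinearMap * leg12 t * leg23 c.symm.toLinearMap

/-- The coefficient `f_{ij}^{pq}` of `f` in the basis `b`, where
`f (b i ⊗ b j) = ∑ p q, f_{ij}^{pq} • b p ⊗ b q`. -/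
def coeff {ι : Type*} (b : Module.Basis ι k V) (f : Module.End k (V ⊗[k] V))
    (i j p q : ι) : k :=
  (b.tensorProduct b).repr (f (b i ⊗ₜ[k] b j)) (p, q)

end Braided

/-! ### The free bialgebra on a matrix of indeterminates -/

section Free

variable (k ι : Type*) [Field k]

/-- The free algebra `F` on indeterminates `T_i^j`. -/
def F : Type _ := FreeAlgebra k (ι × ι)

instance : Ring (F k ι) := inferInstanceAs (Ring (FreeAlgebra k (ι × ι)))

instance : Algebra k (F k ι) := inferInstanceAs (Algebra k (FreeAlgebra k (ι × ι)))

variable {ι}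

/-- The indeterminate `T_i^j` of `F`. -/
def genF (i j : ι) : F k ι := FreeAlgebra.ι k (i, j)

variable {k}

/-- The universal property of `F`: the algebra map with `T_i^j ↦ f i j`. -/
def liftF {A : Type*} [Ring A] [Algebra k A] (f : ι → ι → A) : F k ι →ₐ[k] A :=
  FreeAlgebra.lift k (fun p : ι × ι => f p.1 p.2)

@[simp] lemma liftF_genF {A : Type*} [Ring A] [Algebra k A] (f : ι → ι → A) (i j : ι) :
    liftF f (genF k i j) = f i j :=
  FreeAlgebra.lift_ι_apply _ _

lemma algHomF_ext {A : Type*} [Ring A] [Algebra k A] {f g : F k ι →ₐ[k] A}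
    (h : ∀ i j, f (genF k i j) = g (genF k i j)) : f = g :=
  FreeAlgebra.hom_ext (funext fun p => h p.1 p.2)

variable [Fintype ι] [DecidableEq ι]

/-- `Δ(T_i^j) = ∑ p, T_i^p ⊗ T_p^j` and `ε(T_i^j) = δ_i^j`, extended as algebra maps. -/
instance : Bialgebra k (F k ι) :=
  Bialgebra.ofAlgHom
    (liftF fun i j => ∑ p, genF k i p ⊗ₜ[k] genF k p j)
    (liftF fun i j => if i = j then 1 else 0)
    (by
      apply algHomF_ext
      intro i j
      simp [TensorProduct.sum_tmul, TensorProduct.tmul_sum]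
      rw [Finset.sum_comm])
    (by
      apply algHomF_ext
      intro i j
      simp [TensorProduct.ite_tmul])
    (by
      apply algHomF_ext
      intro i j
      simp [TensorProduct.tmul_ite])

lemma comul_genF (i j : ι) :
    Coalgebra.comul (R := k) (genF k i j) = ∑ p, genF k i p ⊗ₜ[k] genF k p j :=
  liftF_genF _ i j

lemma counit_genF (i j : ι) :
    Coalgebra.counit (R := k) (genF k i j) = if i = j then 1 else 0 :=
  liftF_genF _ i j

end Free

/-! ### The quotient bialgebras `A(c)` and `A(c,t)` -/

section Rel

variable {k ι H : Type*} [Field k] [Fintype ι] [Ring H]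

/-- `∑ m n, s_{ij}^{mn} T_m^p T_n^q - ∑ m n, T_i^m T_j^n s_{mn}^{pq}`. -/
def rel [Algebra k H] (s : ι → ι → ι → ι → k) (T : ι → ι → H) (i j p q : ι) : H :=
  (∑ m, ∑ n, s i j m n • (T m p * T n q)) - ∑ m, ∑ n, s m n p q • (T i m * T j n)

/-- The two-sided ideal generated by all `rel s T i j p q`. -/
def relIdeal [Algebra k H] (s : ι → ι → ι → ι → k) (T : ι → ι → H) : Ideal H :=
  (TwoSidedIdeal.span {x : H | ∃ i j p q, x = rel s T i j p q}).asIdeal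

instance [Algebra k H] (s : ι → ι → ι → ι → k) (T : ι → ι → H) :
    (relIdeal s T).IsTwoSided :=
  inferInstanceAs (TwoSidedIdeal.asIdeal _).IsTwoSided

lemma relIdeal_le_ker [Algebra k H] (s : ι → ι → ι → ι → k) (T : ι → ι → H)
    {B : Type*} [Ring B] [Algebra k B] (φ : H →ₐ[k] B)
    (h : ∀ i j p q, φ (rel s T i j p q) = 0) {x : H} (hx : x ∈ relIdeal s T) : φ x = 0 := by
  have hle : TwoSidedIdeal.span {x : H | ∃ i j p q, x = rel s T i j p q} ≤
      TwoSidedIdeal.ker φ := by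
    rw [TwoSidedIdeal.span_le]
    rintro _ ⟨i, j, p, q, rfl⟩
    exact (TwoSidedIdeal.mem_ker φ).2 (h i j p q)
  exact (TwoSidedIdeal.mem_ker φ).1 (hle (TwoSidedIdeal.mem_asIdeal.1 hx))

lemma rel_mem [Algebra k H] (s : ι → ι → ι → ι → k) (T : ι → ι → H) (i j p q : ι) :
    rel s T i j p q ∈ relIdeal s T :=
  TwoSidedIdeal.mem_asIdeal.2 (TwoSidedIdeal.subset_span ⟨i, j, p, q, rfl⟩)

lemma map_rel [Algebra k H] (s : ι → ι → ι → ι → k) (T : ι → ι → H)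
    {B : Type*} [Ring B] [Algebra k B] (φ : H →ₐ[k] B) (i j p q : ι) :
    φ (rel s T i j p q) = rel s (fun i j => φ (T i j)) i j p q := by
  simp [rel]

/-- `Δ(D_{ij}^{pq}) = D_{ij}^{mn} ⊗ T_m^p T_n^q + T_i^m T_j^n ⊗ D_{mn}^{pq}`. -/
lemma rel_tensor {A B : Type*} [Ring A] [Algebra k A] [Ring B] [Algebra k B]
    (s : ι → ι → ι → ι → k) (T : ι → ι → A) (U : ι → ι → B) (i j p q : ι) :
    rel s (fun i j => ∑ r, T i r ⊗ₜ[k] U r j) i j p q =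
      (∑ m, ∑ n, rel s T i j m n ⊗ₜ[k] (U m p * U n q)) +
        ∑ m, ∑ n, (T i m * T j n) ⊗ₜ[k] rel s U m n p q := by
  have sw : ∀ {M : Type _} [AddCommGroup M] (f : ι → ι → ι → ι → M),
      ∑ a, ∑ b, ∑ c, ∑ d, f a b c d = ∑ c, ∑ d, ∑ a, ∑ b, f a b c d := by
    intro M _ f
    simp_rw [← Fintype.sum_prod_type' (f := fun c d => f _ _ c d)]
    simp_rw [← Fintype.sum_prod_type' (f := fun a b => ∑ x : ι × ι, f a b x.1 x.2)]
    rw [Finset.sum_comm]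
    simp_rw [Fintype.sum_prod_type]
  simp only [rel, TensorProduct.sub_tmul, TensorProduct.tmul_sub, TensorProduct.sum_tmul,
    TensorProduct.tmul_sum, Finset.sum_sub_distrib, TensorProduct.smul_tmul',
    TensorProduct.tmul_smul, Finset.sum_mul_sum, Algebra.TensorProduct.tmul_mul_tmul,
    Finset.smul_sum]
  rw [sw fun m n r r' => (s i j m n • (T m r * T n r')) ⊗ₜ[k] (U r p * U r' q),
    sw fun m n r r' => (s m n p q • (T i r * T j r')) ⊗ₜ[k] (U r m * U r' n),
    sw fun m n r r' => (s r r' m n • (T i r * T j r')) ⊗ₜ[k] (U m p * U n q)]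
  abel

lemma relIdeal_isCoideal [DecidableEq ι] [Bialgebra k H]
    (s : ι → ι → ι → ι → k) (T : ι → ι → H)
    (hΔ : ∀ i j, Coalgebra.comul (R := k) (T i j) = ∑ p, T i p ⊗ₜ[k] T p j)
    (hε : ∀ i j, Coalgebra.counit (R := k) (T i j) = if i = j then 1 else 0) :
    ((relIdeal s T).restrictScalars k).IsCoideal where
  counit_eq_zero x hx := by
    refine relIdeal_le_ker s T (Bialgebra.counitAlgHom k H) (fun i j p q => ?_) hx
    simp [rel, hε]
  map_mkQ_comul_eq_zero x hx := by
    let π := Ideal.Quotient.mkₐ k (relIdeal s T)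
    refine relIdeal_le_ker s T ((Algebra.TensorProduct.map π π).comp
      (Bialgebra.comulAlgHom k H)) (fun i j p q => ?_) hx
    have h0 : ∀ i j p q, rel s (fun i j => π (T i j)) i j p q = 0 := fun i j p q => by
      rw [← map_rel]
      exact Ideal.Quotient.eq_zero_iff_mem.2 (rel_mem s T i j p q)
    rw [map_rel]
    simp only [AlgHom.comp_apply, Bialgebra.comulAlgHom_apply, hΔ, map_sum,
      Algebra.TensorProduct.map_tmul]
    rw [rel_tensor]
    simp [h0]

end Rel

section FRT

variable {k V ι : Type*} [Field k] [AddCommGroup V] [Module k V] [Fintype ι] [DecidableEq ι]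
  (b : Module.Basis ι k V) (c t : Module.End k (V ⊗[k] V))

instance : ((relIdeal (coeff b c) (genF k)).restrictScalars k).IsCoideal :=
  relIdeal_isCoideal _ _ comul_genF counit_genF

/-- The bialgebra `A(c) = F / I(c)`, where `I(c)` is the two-sided ideal generated by the elements
`c_{ij}^{mn} T_m^p T_n^q - T_i^m T_j^n c_{mn}^{pq}`. -/
abbrev FRTBialgebra : Type _ := F k ι ⧸ relIdeal (coeff b c) (genF k)

/-- The class of `T_i^j` in `A(c)`. -/
def genFRT (i j : ι) : FRTBialgebra b c := Ideal.Quotient.mk _ (genF k i j)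

lemma comul_genFRT (i j : ι) :
    Coalgebra.comul (R := k) (genFRT b c i j) = ∑ p, genFRT b c i p ⊗ₜ[k] genFRT b c p j := by
  simp [genFRT, comul_genF]

lemma counit_genFRT (i j : ι) :
    Coalgebra.counit (R := k) (genFRT b c i j) = if i = j then 1 else 0 := by
  simp [genFRT, counit_genF]

instance : ((relIdeal (coeff b t) (genFRT b c)).restrictScalars k).IsCoideal :=
  relIdeal_isCoideal _ _ (comul_genFRT b c) (counit_genFRT b c)

/-- The bialgebra `A(c,t) = A(c) / I(t)`, where `I(t)` is the two-sided ideal generated by the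
elements `t_{ij}^{mn} T_m^p T_n^q - T_i^m T_j^n t_{mn}^{pq}`. -/
abbrev InfFRTBialgebra : Type _ := FRTBialgebra b c ⧸ relIdeal (coeff b t) (genFRT b c)

/-- The canonical projection `A(c) → A(c,t)`. -/
def proj : FRTBialgebra b c →ₐc[k] InfFRTBialgebra b c t :=
  Bialgebra.Quotient.mkBialgHom (relIdeal (coeff b t) (genFRT b c))

/-- The class of `T_i^j` in `A(c,t)`. -/
def genInfFRT (i j : ι) : InfFRTBialgebra b c t := proj b c t (genFRT b c i j)

/-- `R` is the FRT coquasitriangular structure on `A(c)`: it is coquasitriangular and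
`R(T_i^p ⊗ T_j^q) = c_{ji}^{pq}` on generators. -/
structure IsFRTStructure (R : (ConvForm k (FRTBialgebra b c))ˣ) : Prop where
  coquasitriangular : IsCoquasitriangular R
  gen : ∀ i j p q : ι,
    R.val.ofConv (genFRT b c i p ⊗ₜ[k] genFRT b c j q) = coeff b c j i p q

/-- `R' : A(c,t) ⊗ A(c,t) → k` is induced by `R : A(c) ⊗ A(c) → k` on the quotient. -/
def Descends (R : (ConvForm k (FRTBialgebra b c))ˣ)
    (R' : (ConvForm k (InfFRTBialgebra b c t))ˣ) : Prop :=
  ∀ x y : FRTBialgebra b c,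
    R'.val.ofConv (proj b c t x ⊗ₜ[k] proj b c t y) = R.val.ofConv (x ⊗ₜ[k] y)

end FRT

end InfFRT

end

/-!
For a coquasitriangular structure `R`, a form `χ` is an infinitesimal `R`-form exactly when
`R(1 + εχ)` is a quasi-commutative bicharacter with values in the dual numbers `k[ε]`. So `R` and
`χ` both come from bicharacters with values in a commutative `k`-algebra `K`, namely `K = k` and
`K = k[ε]`, and these are determined by their matrices on the generators `T_i^j`. Conversely, an
invertible operator `r` over `K` gives a bicharacter on `A(c,t)` as soon as it is compatible with
the defining relations in both arguments, which means `r₂₃ r₁₂ s₂₃ = s₁₂ r₂₃ r₁₂` and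
`r₁₂ r₂₃ s₁₂ = s₂₃ r₁₂ r₂₃` for `s = c` and `s = t`. The operator `r = (1 + εt) c` has this
property: since `ε² = 0`,
`(1 + εt₂₃) c₂₃ (1 + εt₁₂) c₁₂ = (1 + ε(t₂₃ + c₂₃ t₁₂ c₂₃⁻¹)) c₂₃ c₁₂`, where conjugation by
`c₂₃ c₁₂` carries `c₂₃` and `t₂₃` to `c₁₂` and `t₁₂`, and `t₂₃ + c₂₃ t₁₂ c₂₃⁻¹` commutes with `c₁₂`
and `t₁₂`; the other identity follows by exchanging the two legs.
-/

noncomputable section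

namespace InfFRT

open Coalgebra
open scoped Kronecker

section Convolution

variable {k A B C D : Type*} [CommRing k] [Ring A] [Algebra k A] [Ring B] [Algebra k B]
  [AddCommGroup C] [Module k C] [Coalgebra k C] [AddCommGroup D] [Module k D] [Coalgebra k D]

/-- Precomposition with a coalgebra map, as a map of convolution algebras. -/
def pull (φ : C →ₗc[k] D) : WithConv (D →ₗ[k] A) →ₐ[k] WithConv (C →ₗ[k] A) :=
  AlgHom.ofLinearMap
    { toFun := fun f => toConv (f.ofConv ∘ₗ φ.toLinearMap)
      map_add' := fun _ _ => rfl
      map_smul' := fun _ _ => rfl }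
    (by ext x; simp)
    (fun f g => congrArg toConv (LinearMap.convMul_comp_coalgHom_distrib f g φ))

@[simp] lemma pull_apply (φ : C →ₗc[k] D) (f : WithConv (D →ₗ[k] A)) (x : C) :
    pull φ f x = f (φ x) := rfl

/-- Postcomposition with an algebra map, as a map of convolution algebras. -/
def push (φ : A →ₐ[k] B) : WithConv (C →ₗ[k] A) →ₐ[k] WithConv (C →ₗ[k] B) :=
  AlgHom.ofLinearMap
    { toFun := fun f => toConv (φ.toLinearMap ∘ₗ f.ofConv)
      map_add' := fun f g => by ext x; simp
      map_smul' := fun f g => by ext x; simp }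
    (by ext x; simp)
    (fun f g => congrArg toConv (LinearMap.algHom_comp_convMul_distrib φ f g))

@[simp] lemma push_apply (φ : A →ₐ[k] B) (f : WithConv (C →ₗ[k] A)) (x : C) :
    push φ f x = φ (f x) := rfl

variable {M κ : Type*} [AddCommGroup M] [Module k M] {a : C} (r : Repr k a κ)

lemma sum_counit_left_smul (f : C →ₗ[k] M) :
    ∑ i ∈ r.index, counit (R := k) (r.left i) • f (r.right i) = f a := by
  simp_rw [← map_smul, ← map_sum, sum_counit_smul]

lemma sum_counit_right_smul (f : C →ₗ[k] M) :
    ∑ i ∈ r.index, counit (R := k) (r.right i) • f (r.left i) = f a := by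
  simpa only [map_sum, TensorProduct.rid_tmul, one_smul] using
    congrArg (TensorProduct.rid k M) (sum_map_tmul_counit_eq f a (repr := r))

variable (k C) in
/-- The map `a ↦ ε(a) x`, by which the values `x ∈ A` become constants of the convolution
algebra. -/
def convConst : A →ₐ[k] WithConv (C →ₗ[k] A) :=
  AlgHom.ofLinearMap
    { toFun x := toConv ((counit (R := k)).smulRight x)
      map_add' x y := by ext; simp
      map_smul' r x := by ext a; exact smul_comm (counit (R := k) a) r x }
    (by ext; simp [Algebra.algebraMap_eq_smul_one])
    (fun x y => by
      ext a
      rw [(ℛ k a).convMul_apply]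
      simpa [smul_mul_smul_comm, mul_smul] using
        (sum_counit_right_smul (ℛ k a) ((counit (R := k)).smulRight (x * y))).symm)

@[simp] lemma convConst_apply (x : A) (a : C) :
    convConst k C x a = counit (R := k) a • x := rfl

lemma convConst_mul_apply (x : A) (f : WithConv (C →ₗ[k] A)) (a : C) :
    (convConst k C x * f) a = x * f a := by
  rw [(ℛ k a).convMul_apply, ← sum_counit_left_smul (ℛ k a) f.ofConv, Finset.mul_sum]
  simp

lemma mul_convConst_apply (f : WithConv (C →ₗ[k] A)) (x : A) (a : C) :
    (f * convConst k C x) a = f a * x := by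
  rw [(ℛ k a).convMul_apply, ← sum_counit_right_smul (ℛ k a) f.ofConv, Finset.sum_mul]
  simp

end Convolution

section Bilinear

variable {k H A : Type*} [CommRing k] [Ring H] [Bialgebra k H] [Ring A] [Algebra k A]

lemma bilin_ext {M : Type*} [AddCommGroup M] [Module k M] {f g : WithConv (H ⊗[k] H →ₗ[k] M)}
    (h : ∀ a b, f (a ⊗ₜ b) = g (a ⊗ₜ b)) : f = g := by
  ext a b
  exact h a b

lemma convMul_tmul (f g : WithConv (H ⊗[k] H →ₗ[k] A)) {κ κ' : Type*} {a b : H}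
    (r : Repr k a κ) (s : Repr k b κ') :
    (f * g) (a ⊗ₜ b) = ∑ i ∈ r.index, ∑ j ∈ s.index,
      f (r.left i ⊗ₜ s.left j) * g (r.right i ⊗ₜ s.right j) := by
  simpa [Finset.sum_product] using (r.tmul s).convMul_apply f g

variable (k H A) in
/-- Currying, as an isomorphism of convolution algebras. -/
def convCurry :
    WithConv (H ⊗[k] H →ₗ[k] A) ≃ₐ[k] WithConv (H →ₗ[k] WithConv (H →ₗ[k] A)) :=
  AlgEquiv.ofLinearEquiv
    { toFun f := toConv ((WithConv.linearEquiv k _).symm.toLinearMap ∘ₗ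
        TensorProduct.curry f.ofConv)
      invFun g := toConv (TensorProduct.lift ((WithConv.linearEquiv k _).toLinearMap ∘ₗ g.ofConv))
      map_add' _ _ := rfl
      map_smul' _ _ := rfl
      left_inv f := by ext; rfl
      right_inv g := by ext; rfl }
    (by
      ext a b
      change (1 : WithConv (H ⊗[k] H →ₗ[k] A)) (a ⊗ₜ b) = _
      simp [Algebra.smul_def, ← map_mul, mul_comm])
    (fun f g => by
      ext a b
      change (f * g) (a ⊗ₜ b) = ((_ * _ : WithConv (H →ₗ[k] WithConv (H →ₗ[k] A))) a).ofConv b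
      rw [convMul_tmul f g (ℛ k a) (ℛ k b), (ℛ k a).convMul_apply, ofConv_sum,
        LinearMap.sum_apply]
      exact Finset.sum_congr rfl fun i _ => ((ℛ k b).convMul_apply
        (toConv (TensorProduct.curry f.ofConv _)) (toConv (TensorProduct.curry g.ofConv _))).symm)

variable (k H) in
/-- The flip `a ⊗ b ↦ b ⊗ a`. -/
def swapHom : H ⊗[k] H →ₗc[k] H ⊗[k] H :=
  (Bialgebra.TensorProduct.comm k H H : H ⊗[k] H →ₐc[k] H ⊗[k] H)

@[simp] lemma swapHom_tmul (a b : H) : swapHom k H (a ⊗ₜ b) = b ⊗ₜ a := rfl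

/-- `a ↦ f(a ⊗ -)`. -/
def legL (f : WithConv (H ⊗[k] H →ₗ[k] A)) : H →ₗ[k] WithConv (H →ₗ[k] A) :=
  (convCurry k H A f).ofConv

/-- `b ↦ f(- ⊗ b)`. -/
def legR (f : WithConv (H ⊗[k] H →ₗ[k] A)) : H →ₗ[k] WithConv (H →ₗ[k] A) :=
  legL (pull (swapHom k H) f)

@[simp] lemma legL_apply (f : WithConv (H ⊗[k] H →ₗ[k] A)) (a b : H) :
    legL f a b = f (a ⊗ₜ b) := rfl

@[simp] lemma legR_apply (f : WithConv (H ⊗[k] H →ₗ[k] A)) (a b : H) :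
    legR f b a = f (a ⊗ₜ b) := rfl

variable (k H) in
/-- `b ↦ 1 ⊗ b`. -/
def oneTmulHom : H →ₗc[k] H ⊗[k] H :=
  (Coalgebra.TensorProduct.map (Bialgebra.unitBialgHom k H : k →ₗc[k] H) (.id k H)).comp
    (Coalgebra.TensorProduct.lid k H).symm.toCoalgHom

lemma legL_one_eq_pull (f : WithConv (H ⊗[k] H →ₗ[k] A)) :
    legL f 1 = pull (oneTmulHom k H) f := by
  ext b
  simp [oneTmulHom]

lemma legL_one_eq_one {f : WithConv (H ⊗[k] H →ₗ[k] A)} (hf : IsUnit f)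
    (h : legL f 1 = legL f 1 * legL f 1) : legL f 1 = 1 := by
  rw [← IsIdempotentElem.iff_eq_one_of_isUnit (by rw [legL_one_eq_pull]; exact hf.map _)]
  exact h.symm

end Bilinear

section Bicharacter

variable {k H A : Type*} [CommRing k] [Ring H] [Bialgebra k H] [Ring A] [Algebra k A]

/-- A form `f` with `f(ab ⊗ c) = f(a ⊗ c₁) f(b ⊗ c₂)` and `f(a ⊗ bc) = f(a₁ ⊗ c) f(a₂ ⊗ b)` that is
compatible with the unit of `H`: a coquasitriangular structure without quasi-commutativity, with
values in an arbitrary algebra. -/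
structure IsBicharacter (f : WithConv (H ⊗[k] H →ₗ[k] A)) : Prop where
  mul_left : ∀ a b, legL f (a * b) = legL f a * legL f b
  mul_right : ∀ b c, legR f (b * c) = legR f c * legR f b
  one_left : legL f 1 = 1
  one_right : legR f 1 = 1

lemma isBicharacter_of_isUnit {f : WithConv (H ⊗[k] H →ₗ[k] A)} (hf : IsUnit f)
    (hl : ∀ a b, legL f (a * b) = legL f a * legL f b)
    (hr : ∀ b c, legR f (b * c) = legR f c * legR f b) : IsBicharacter f :=
  ⟨hl, hr, legL_one_eq_one hf (by rw [← hl, mul_one]),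
    legL_one_eq_one (hf.map (pull (swapHom k H))) (by
      change legR f 1 = legR f 1 * legR f 1
      rw [← hr, mul_one])⟩

namespace IsBicharacter

variable {f : WithConv (H ⊗[k] H →ₗ[k] A)} (hf : IsBicharacter f)
include hf

/-- `a ↦ f(a ⊗ -)`, as an algebra map. -/
def left : H →ₐ[k] WithConv (H →ₗ[k] A) :=
  AlgHom.ofLinearMap (legL f) hf.one_left hf.mul_left

/-- `b ↦ f(- ⊗ b)`, as an algebra map with values in the opposite algebra. -/
def right : H →ₐ[k] (WithConv (H →ₗ[k] A))ᵐᵒᵖ :=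
  AlgHom.ofLinearMap ((MulOpposite.opLinearEquiv k).toLinearMap ∘ₗ legR f)
    (by simp [hf.one_right]) (by simp [hf.mul_right])

end IsBicharacter

end Bicharacter

section TripleProduct

variable {k H : Type*} [CommRing k] [Ring H] [Bialgebra k H]

variable (k H) in
/-- `a ⊗ b ⊗ c ↦ ε(c) a ⊗ b`. -/
def hom12 : (H ⊗[k] H) ⊗[k] H →ₗc[k] H ⊗[k] H :=
  (Coalgebra.TensorProduct.rid k k (H ⊗[k] H)).toCoalgHom.comp
    (Coalgebra.TensorProduct.map (.id k (H ⊗[k] H)) (Coalgebra.counitCoalgHom k H))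

variable (k H) in
/-- `a ⊗ b ⊗ c ↦ ε(a) b ⊗ c`. -/
def hom23 : (H ⊗[k] H) ⊗[k] H →ₗc[k] H ⊗[k] H :=
  ((Coalgebra.TensorProduct.lid k (H ⊗[k] H)).toCoalgHom.comp
    (Coalgebra.TensorProduct.map (Coalgebra.counitCoalgHom k H) (.id k (H ⊗[k] H)))).comp
    (Coalgebra.TensorProduct.assoc k k H H H).toCoalgHom

variable (k H) in
/-- `a ⊗ b ⊗ c ↦ ε(b) a ⊗ c`. -/
def hom13 : (H ⊗[k] H) ⊗[k] H →ₗc[k] H ⊗[k] H :=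
  (hom23 k H).comp (Coalgebra.TensorProduct.map (swapHom k H) (.id k H))

variable (k H) in
/-- `a ⊗ b ⊗ c ↦ c ⊗ b ⊗ a`. -/
def reverseHom : (H ⊗[k] H) ⊗[k] H →ₗc[k] (H ⊗[k] H) ⊗[k] H :=
  ((Coalgebra.TensorProduct.assoc k k H H H).symm.toCoalgHom.comp
    (Coalgebra.TensorProduct.map (.id k H) (swapHom k H))).comp
    (Bialgebra.TensorProduct.comm k (H ⊗[k] H) H : (H ⊗[k] H) ⊗[k] H →ₐc[k] H ⊗[k] (H ⊗[k] H))

@[simp] lemma reverseHom_tmul (a b c : H) :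
    reverseHom k H (a ⊗ₜ b ⊗ₜ c) = c ⊗ₜ b ⊗ₜ a := rfl

lemma trilin_ext {f g : WithConv ((H ⊗[k] H) ⊗[k] H →ₗ[k] k)}
    (h : ∀ a b c, f (a ⊗ₜ b ⊗ₜ c) = g (a ⊗ₜ b ⊗ₜ c)) : f = g := by
  ext a b c
  exact h a b c

end TripleProduct

section Legs

variable {k H : Type*} [Field k] [Ring H] [Bialgebra k H]

lemma form12_eq_pull (f : ConvForm k H) : form12 f = pull (hom12 k H) f :=
  trilin_ext fun a b c => by simp [form12, hom12, mul_comm]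

lemma form23_eq_pull (f : ConvForm k H) : form23 f = pull (hom23 k H) f :=
  trilin_ext fun a b c => by simp [form23, hom23]

lemma form13_eq_pull (f : ConvForm k H) : form13 f = pull (hom13 k H) f :=
  trilin_ext fun a b c => by
    simp only [form13, form23_eq_pull, hom13]
    rfl

lemma formMulLeft_apply (f : ConvForm k H) (a b c : H) :
    formMulLeft f (a ⊗ₜ b ⊗ₜ c) = legL f (a * b) c := rfl

lemma formMulRight_apply (f : ConvForm k H) (a b c : H) :
    formMulRight f (a ⊗ₜ b ⊗ₜ c) = legR f (b * c) a := rfl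

lemma form13_mul_form23_apply (f g : ConvForm k H) (a b c : H) :
    (form13 f * form23 g) (a ⊗ₜ b ⊗ₜ c) = (legL f a * legL g b) c := by
  rw [(((ℛ k a).tmul (ℛ k b)).tmul (ℛ k c)).convMul_apply, (ℛ k c).convMul_apply]
  simp only [Repr.tmul_index, Finset.sum_product_right, Repr.tmul_left, Repr.tmul_right]
  refine Finset.sum_congr rfl fun l _ => ?_
  have hf := sum_counit_right_smul (ℛ k a) (legR f ((ℛ k c).left l)).ofConv
  have hg := sum_counit_left_smul (ℛ k b) (legR g ((ℛ k c).right l)).ofConv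
  simp only [legR_apply] at hf hg
  rw [legL_apply, legL_apply, ← hf, ← hg, Finset.sum_mul_sum, Finset.sum_comm]
  refine Finset.sum_congr rfl fun i _ => Finset.sum_congr rfl fun j _ => ?_
  simp [form13, form23]
  ring

lemma form13_mul_form12_apply (f g : ConvForm k H) (a b c : H) :
    (form13 f * form12 g) (a ⊗ₜ b ⊗ₜ c) = (legR f c * legR g b) a := by
  have hf : pull (reverseHom k H) (form13 (pull (swapHom k H) f)) = form13 f :=
    trilin_ext fun a b c => by simp [form13, form23]
  have hg : pull (reverseHom k H) (form23 (pull (swapHom k H) g)) = form12 g :=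
    trilin_ext fun a b c => by simp [form12, form23, mul_comm]
  rw [← hf, ← hg, ← map_mul]
  exact form13_mul_form23_apply _ _ c b a

lemma formMulLeft_eq_iff (f : ConvForm k H) :
    formMulLeft f = form13 f * form23 f ↔ ∀ a b, legL f (a * b) = legL f a * legL f b := by
  refine ⟨fun h a b => ?_, fun h => trilin_ext fun a b c => ?_⟩
  · ext c
    rw [← form13_mul_form23_apply, ← h, formMulLeft_apply]
  · rw [form13_mul_form23_apply, ← h, formMulLeft_apply]

lemma formMulRight_eq_iff (f : ConvForm k H) :
    formMulRight f = form13 f * form12 f ↔ ∀ b c, legR f (b * c) = legR f c * legR f b := by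
  refine ⟨fun h b c => ?_, fun h => trilin_ext fun a b c => ?_⟩
  · ext a
    rw [← form13_mul_form12_apply, ← h, formMulRight_apply]
  · rw [form13_mul_form12_apply, ← h, formMulRight_apply]

lemma IsCoquasitriangular.isBicharacter {R : (ConvForm k H)ˣ} (hR : IsCoquasitriangular R) :
    IsBicharacter (R : ConvForm k H) :=
  isBicharacter_of_isUnit R.isUnit ((formMulLeft_eq_iff _).1 hR.mul_left)
    ((formMulRight_eq_iff _).1 hR.mul_right)

end Legs

section Kronecker

variable {k B m n : Type*} [CommRing k] [Ring B] [Algebra k B] [Fintype m] [DecidableEq m]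
  [Fintype n] [DecidableEq n]

variable (k B m n) in
/-- `A ↦ A ⊗ 1`. -/
def kronLeft : Matrix m m B →ₐ[k] Matrix (m × n) (m × n) B :=
  (Matrix.compAlgEquiv m n B k).toAlgHom.comp (Matrix.scalarAlgHom n k).mapMatrix

variable (k B m n) in
/-- `A ↦ 1 ⊗ A`. -/
def kronRight : Matrix n n B →ₐ[k] Matrix (m × n) (m × n) B :=
  (Matrix.compAlgEquiv m n B k).toAlgHom.comp (Matrix.scalarAlgHom m k)

lemma kronLeft_apply (A : Matrix m m B) (x y : m × n) :
    kronLeft k B m n A x y = if x.2 = y.2 then A x.1 y.1 else 0 := by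
  simp [kronLeft, Matrix.diagonal_apply]

lemma kronRight_apply (A : Matrix n n B) (x y : m × n) :
    kronRight k B m n A x y = if x.1 = y.1 then A x.2 y.2 else 0 := by
  simp [kronRight, Matrix.diagonal_apply, apply_ite (fun M : Matrix n n B => M x.2 y.2)]

lemma kronLeft_mul_kronRight_apply (A : Matrix m m B) (D : Matrix n n B) (x y : m × n) :
    (kronLeft k B m n A * kronRight k B m n D) x y = A x.1 y.1 * D x.2 y.2 := by
  simp [Matrix.mul_apply, Fintype.sum_prod_type, kronLeft_apply, kronRight_apply]

lemma kronRight_mul_kronLeft_apply (A : Matrix m m B) (D : Matrix n n B) (x y : m × n) :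
    (kronRight k B m n D * kronLeft k B m n A) x y = D x.2 y.2 * A x.1 y.1 := by
  simp [Matrix.mul_apply, Fintype.sum_prod_type_right, kronLeft_apply, kronRight_apply]

lemma commute_kronLeft_kronRight {A : Matrix m m B} {D : Matrix n n B}
    (h : ∀ i p j q, Commute (A i p) (D j q)) :
    Commute (kronLeft k B m n A) (kronRight k B m n D) := by
  ext x y
  rw [kronLeft_mul_kronRight_apply, kronRight_mul_kronLeft_apply, (h _ _ _ _).eq]

end Kronecker

section Comatrix

variable {k C A ι : Type*} [CommRing k] [AddCommGroup C] [Module k C] [Coalgebra k C] [Ring A]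
  [Algebra k A] [Fintype ι] [DecidableEq ι]

variable (k) in
/-- `T` is a multiplicative matrix: `Δ(T_i^j) = ∑ₚ T_i^p ⊗ T_p^j` and `ε(T_i^j) = δ_i^j`. -/
structure IsComatrix (T : Matrix ι ι C) : Prop where
  comul : ∀ i j, Coalgebra.comul (R := k) (T i j) = ∑ p, T i p ⊗ₜ[k] T p j
  counit : ∀ i j, Coalgebra.counit (R := k) (T i j) = if i = j then 1 else 0

namespace IsComatrix

variable {T : Matrix ι ι C} (hT : IsComatrix k T)
include hT

/-- `Δ(T_i^j) = ∑ₚ T_i^p ⊗ T_p^j`. -/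
@[simps index left right]
def repr (i j : ι) : Repr k (T i j) ι where
  index := Finset.univ
  left p := T i p
  right p := T p j
  eq := (hT.comul i j).symm

lemma map_one : T.map (1 : WithConv (C →ₗ[k] A)) = 1 := by
  ext i j
  simp [hT.counit, Matrix.one_apply, apply_ite (algebraMap k A)]

lemma map_mul (f g : WithConv (C →ₗ[k] A)) : T.map (f * g) = T.map f * T.map g := by
  ext i j
  rw [Matrix.map_apply, (hT.repr i j).convMul_apply]
  simp [Matrix.mul_apply]

/-- Evaluation on a multiplicative matrix turns convolution into matrix multiplication. -/
def evalHom : WithConv (C →ₗ[k] A) →ₐ[k] Matrix ι ι A :=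
  AlgHom.ofLinearMap
    { toFun f := T.map f
      map_add' _ _ := rfl
      map_smul' _ _ := rfl }
    hT.map_one hT.map_mul

end IsComatrix

/-- The entries of a matrix-valued map, as a matrix over the convolution algebra. -/
def convEntries : WithConv (C →ₗ[k] Matrix ι ι A) →+* Matrix ι ι (WithConv (C →ₗ[k] A)) where
  toFun f := .of fun i j => toConv (Matrix.entryLinearMap k A i j ∘ₗ f.ofConv)
  map_zero' := rfl
  map_add' _ _ := rfl
  map_one' := by
    ext i j x
    by_cases h : i = j <;> simp [h, Matrix.one_apply, Matrix.algebraMap_matrix_apply]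
  map_mul' f g := by
    ext i j x
    simp only [Matrix.of_apply, Matrix.mul_apply, ofConv_sum, LinearMap.sum_apply,
      (ℛ k x).convMul_apply, LinearMap.comp_apply, Matrix.entryLinearMap_apply, Matrix.sum_apply]
    exact Finset.sum_comm

end Comatrix

section RelationMatrix

variable {k ι B : Type*} [CommRing k] [Fintype ι] [Ring B] [Algebra k B]

/-- The tensor `s`, as the matrix over `B` with rows `(i, j)` and columns `(p, q)`. -/
def relMatrix (B : Type*) [Ring B] [Algebra k B] (s : ι → ι → ι → ι → k) :
    Matrix (ι × ι) (ι × ι) B :=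
  .of fun x y => algebraMap k B (s x.1 x.2 y.1 y.2)

variable (s : ι → ι → ι → ι → k)

lemma relMatrix_mul_apply {κ : Type*} (M : Matrix (ι × ι) κ B) (i j : ι) (z : κ) :
    (relMatrix B s * M) (i, j) z = ∑ m, ∑ n, s i j m n • M (m, n) z := by
  simp [relMatrix, Matrix.mul_apply, Fintype.sum_prod_type, Algebra.smul_def]

lemma mul_relMatrix_apply {κ : Type*} (M : Matrix κ (ι × ι) B) (z : κ) (p q : ι) :
    (M * relMatrix B s) z (p, q) = ∑ m, ∑ n, s m n p q • M z (m, n) := by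
  simp [relMatrix, Matrix.mul_apply, Fintype.sum_prod_type, Algebra.smul_def, Algebra.commutes]

end RelationMatrix

section Relations

variable {k ι B : Type*} [Field k] [Fintype ι] [Ring B] [Algebra k B]

/-- The quadratic relations `∑ s_{ij}^{mn} X_m^p X_n^q = ∑ X_i^m X_j^n s_{mn}^{pq}`. -/
def SatisfiesRel (s : ι → ι → ι → ι → k) (X : Matrix ι ι B) : Prop :=
  ∀ i j p q, rel s X i j p q = 0

lemma SatisfiesRel.map {C : Type*} [Ring C] [Algebra k C] {s : ι → ι → ι → ι → k}
    {X : Matrix ι ι B} (h : SatisfiesRel s X) (φ : B →ₐ[k] C) : SatisfiesRel s (X.map φ) :=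
  fun i j p q => by
    have hφ := map_rel s X φ i j p q
    rw [h i j p q, map_zero] at hφ
    exact hφ.symm

variable [DecidableEq ι] (s : ι → ι → ι → ι → k) (X : Matrix ι ι B)

lemma satisfiesRel_iff :
    SatisfiesRel s X ↔ Commute (relMatrix B s) (kronLeft k B ι ι X * kronRight k B ι ι X) := by
  simp only [commute_iff_eq, ← Matrix.ext_iff, Prod.forall, relMatrix_mul_apply,
    mul_relMatrix_apply, kronLeft_mul_kronRight_apply, SatisfiesRel, rel, sub_eq_zero]

lemma satisfiesRel_map_op_iff :
    SatisfiesRel s (X.map MulOpposite.op) ↔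
      Commute (relMatrix B s) (kronRight k B ι ι X * kronLeft k B ι ι X) := by
  simp only [commute_iff_eq, ← Matrix.ext_iff, Prod.forall, relMatrix_mul_apply,
    mul_relMatrix_apply, kronRight_mul_kronLeft_apply, SatisfiesRel, rel, sub_eq_zero,
    Matrix.map_apply, ← MulOpposite.op_mul, ← MulOpposite.op_smul, ← Finset.op_sum,
    MulOpposite.op_inj]

lemma satisfiesRel_map_op_inv_iff (u : (Matrix ι ι B)ˣ) :
    SatisfiesRel s ((↑u⁻¹ : Matrix ι ι B).map MulOpposite.op) ↔
      SatisfiesRel s (u : Matrix ι ι B) := by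
  let v := Units.map (kronLeft k B ι ι).toMonoidHom u * Units.map (kronRight k B ι ι).toMonoidHom u
  have hv : (↑v⁻¹ : Matrix (ι × ι) (ι × ι) B) =
      kronRight k B ι ι ↑u⁻¹ * kronLeft k B ι ι ↑u⁻¹ := by
    simp [v, mul_inv_rev]
  rw [satisfiesRel_map_op_iff, satisfiesRel_iff, ← hv, Commute.units_inv_right_iff]
  rfl

end Relations

section Generators

variable {k ι H B : Type*} [CommRing k] [Fintype ι] [DecidableEq ι] [Ring H] [Bialgebra k H]
  [Ring B] [Algebra k B]

variable (k) in
/-- The entries of the multiplicative matrix `T` generate `H` as an algebra. -/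
structure IsGeneratingComatrix (T : Matrix ι ι H) : Prop extends IsComatrix k T where
  adjoin_eq_top : Algebra.adjoin k (Set.range fun x : ι × ι => T x.1 x.2) = ⊤

/-- The convolution product of two algebra maps with commuting values is an algebra map. -/
def convHom (f g : H →ₐ[k] B) (h : ∀ x y, Commute (f x) (g y)) : H →ₐ[k] B :=
  (Algebra.TensorProduct.lift f g h).comp (Bialgebra.comulAlgHom k H)

lemma convHom_apply (f g : H →ₐ[k] B) (h : ∀ x y, Commute (f x) (g y)) {κ : Type*} {x : H}
    (r : Repr k x κ) : convHom f g h x = ∑ i ∈ r.index, f (r.left i) * g (r.right i) := by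
  simp [convHom, ← r.eq]

/-- The linear map underlying an antimultiplicative map. -/
def unopMap (ψ : H →ₐ[k] Bᵐᵒᵖ) : H →ₗ[k] B :=
  (MulOpposite.opLinearEquiv k).symm.toLinearMap ∘ₗ ψ.toLinearMap

@[simp] lemma unopMap_apply (ψ : H →ₐ[k] Bᵐᵒᵖ) (x : H) : unopMap ψ x = (ψ x).unop := rfl

namespace IsGeneratingComatrix

variable {T : Matrix ι ι H} (hT : IsGeneratingComatrix k T)
include hT

lemma induction {P : H → Prop} (gen : ∀ i j, P (T i j))
    (algebraMap : ∀ r : k, P (algebraMap k H r)) (add : ∀ a b, P a → P b → P (a + b))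
    (mul : ∀ a b, P a → P b → P (a * b)) (x : H) : P x := by
  have hx : x ∈ Algebra.adjoin k (Set.range fun x : ι × ι => T x.1 x.2) := by
    rw [hT.adjoin_eq_top]; trivial
  induction hx using Algebra.adjoin_induction with
  | mem x hx => obtain ⟨⟨i, j⟩, rfl⟩ := hx; exact gen i j
  | algebraMap r => exact algebraMap r
  | add a b _ _ ha hb => exact add a b ha hb
  | mul a b _ _ ha hb => exact mul a b ha hb

lemma algHom_ext {f g : H →ₐ[k] B} (h : ∀ i j, f (T i j) = g (T i j)) : f = g :=
  AlgHom.ext_of_adjoin_eq_top hT.adjoin_eq_top (by rintro _ ⟨⟨i, j⟩, rfl⟩; exact h i j)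

lemma semiconjBy {f g : H →ₐ[k] B} {N : B} (h : ∀ i j, SemiconjBy N (f (T i j)) (g (T i j)))
    (x : H) : SemiconjBy N (f x) (g x) := by
  induction x using hT.induction with
  | gen i j => exact h i j
  | algebraMap r =>
    simp only [AlgHom.commutes]
    exact (Algebra.commutes r N).symm
  | add a b ha hb => simpa only [map_add] using ha.add_right hb
  | mul a b ha hb => simpa only [map_mul] using ha.mul_right hb

lemma conv_mul_unop_eq_one {φ : H →ₐ[k] B} {ψ : H →ₐ[k] Bᵐᵒᵖ}
    (h : T.map φ * T.map (unopMap ψ) = 1) : toConv φ.toLinearMap * toConv (unopMap ψ) = 1 := by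
  ext x
  induction x using hT.induction with
  | gen i j =>
    exact congrFun₂ ((hT.map_mul (toConv φ.toLinearMap) (toConv (unopMap ψ))).trans
      (h.trans hT.map_one.symm)) i j
  | algebraMap r => simp [Algebra.TensorProduct.one_def, Algebra.algebraMap_eq_smul_one]
  | add a b ha hb => rw [map_add, map_add, ha, hb]
  | mul a b ha hb =>
    rw [((ℛ k a).mul (ℛ k b)).convMul_apply]
    rw [(ℛ k a).convMul_apply] at ha
    rw [(ℛ k b).convMul_apply] at hb
    simp only [AlgHom.toLinearMap_apply, unopMap_apply, LinearMap.convOne_apply, Repr.mul_index,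
      Repr.mul_left, Repr.mul_right, Finset.sum_product, map_mul, MulOpposite.unop_mul,
      Bialgebra.counit_mul] at ha hb ⊢
    rw [← ha, Finset.sum_mul]
    refine Finset.sum_congr rfl fun i _ => ?_
    rw [mul_assoc, ← Algebra.commutes, ← hb, Finset.sum_mul, Finset.mul_sum]
    simp only [mul_assoc]

lemma conv_unop_mul_eq_one {φ : H →ₐ[k] B} {ψ : H →ₐ[k] Bᵐᵒᵖ}
    (h : T.map (unopMap ψ) * T.map φ = 1) : toConv (unopMap ψ) * toConv φ.toLinearMap = 1 := by
  ext x
  induction x using hT.induction with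
  | gen i j =>
    exact congrFun₂ ((hT.map_mul (toConv (unopMap ψ)) (toConv φ.toLinearMap)).trans
      (h.trans hT.map_one.symm)) i j
  | algebraMap r => simp [Algebra.TensorProduct.one_def, Algebra.algebraMap_eq_smul_one]
  | add a b ha hb => rw [map_add, map_add, ha, hb]
  | mul a b ha hb =>
    rw [((ℛ k a).mul (ℛ k b)).convMul_apply]
    rw [(ℛ k a).convMul_apply] at ha
    rw [(ℛ k b).convMul_apply] at hb
    simp only [AlgHom.toLinearMap_apply, unopMap_apply, LinearMap.convOne_apply, Repr.mul_index,
      Repr.mul_left, Repr.mul_right, Finset.sum_product_right, map_mul, MulOpposite.unop_mul,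
      Bialgebra.counit_mul] at ha hb ⊢
    rw [← Algebra.commutes, ← hb, Finset.sum_mul]
    refine Finset.sum_congr rfl fun i _ => ?_
    rw [mul_assoc, ← Algebra.commutes, ← ha, Finset.sum_mul, Finset.mul_sum]
    simp only [mul_assoc]

end IsGeneratingComatrix

end Generators

section Presentation

variable {k ι H B : Type*} [Field k] [Fintype ι] [DecidableEq ι] [Ring H] [Bialgebra k H]
  [Ring B] [Algebra k B]

/-- `H` is the bialgebra generated by the entries of the multiplicative matrix `T`, subject to the
relations `rel s T = 0` for `s ∈ S`. -/
structure IsPresentation (S : Set (ι → ι → ι → ι → k)) (T : Matrix ι ι H) : Prop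
    extends IsGeneratingComatrix k T where
  satisfiesRel : ∀ s ∈ S, SatisfiesRel s T
  ker_le : ∀ x, liftF (k := k) T x = 0 → x ∈ TwoSidedIdeal.span
    {x : F k ι | ∃ s ∈ S, ∃ i j p q, x = rel s (genF k) i j p q}

namespace IsPresentation

variable {S : Set (ι → ι → ι → ι → k)} {T : Matrix ι ι H} (hT : IsPresentation S T)
include hT

lemma surjective_liftF : Function.Surjective (liftF (k := k) T) := by
  rw [← AlgHom.range_eq_top, eq_top_iff, ← hT.adjoin_eq_top, Algebra.adjoin_le_iff]
  rintro _ ⟨⟨i, j⟩, rfl⟩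
  exact ⟨genF k i j, liftF_genF T i j⟩

lemma exists_lift (X : Matrix ι ι B) (hX : ∀ s ∈ S, SatisfiesRel s X) :
    ∃ φ : H →ₐ[k] B, T.map φ = X := by
  have hXgen (i j : ι) : liftF (k := k) X (genF k i j) = X i j := liftF_genF X i j
  have hTgen (i j : ι) : liftF (k := k) T (genF k i j) = T i j := liftF_genF T i j
  have hker (x : F k ι) (hx : x ∈ RingHom.ker (liftF (k := k) T)) : liftF (k := k) X x = 0 := by
    have hle : TwoSidedIdeal.span
        {x : F k ι | ∃ s ∈ S, ∃ i j p q, x = rel s (genF k) i j p q} ≤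
        TwoSidedIdeal.ker (liftF (k := k) X) := by
      rw [TwoSidedIdeal.span_le]
      rintro _ ⟨s, hs, i, j, p, q, rfl⟩
      refine (TwoSidedIdeal.mem_ker _).2 ?_
      simpa only [map_rel, hXgen] using hX s hs i j p q
    exact (TwoSidedIdeal.mem_ker _).1 (hle (hT.ker_le x hx))
  refine ⟨(Ideal.Quotient.liftₐ _ (liftF (k := k) X) hker).comp
    (Ideal.quotientKerAlgEquivOfSurjective hT.surjective_liftF).symm.toAlgHom, ?_⟩
  ext i j
  rw [Matrix.map_apply, ← hTgen, ← hXgen]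
  exact congrArg (Ideal.Quotient.liftₐ _ (liftF (k := k) X) hker)
    (Ideal.quotientKerAlgEquivOfSurjective_symm_apply hT.surjective_liftF (genF k i j))

lemma exists_antiLift (X : Matrix ι ι B) (hX : ∀ s ∈ S, SatisfiesRel s (X.map MulOpposite.op)) :
    ∃ ψ : H →ₐ[k] Bᵐᵒᵖ, T.map (unopMap ψ) = X := by
  obtain ⟨ψ, hψ⟩ := hT.exists_lift _ hX
  exact ⟨ψ, by ext i j; simpa using congrArg MulOpposite.unop (congrFun₂ hψ i j)⟩

lemma isUnit_toConv {φ : H →ₐ[k] B} (hφ : IsUnit (T.map φ)) : IsUnit (toConv φ.toLinearMap) := by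
  obtain ⟨u, hu⟩ := hφ
  obtain ⟨ψ, hψ⟩ := hT.exists_antiLift (↑u⁻¹ : Matrix ι ι B) fun s hs =>
    (satisfiesRel_map_op_inv_iff s u).2 (hu ▸ (hT.satisfiesRel s hs).map φ)
  exact ⟨⟨_, _, hT.conv_mul_unop_eq_one (by rw [hψ, ← hu, u.mul_inv]),
    hT.conv_unop_mul_eq_one (by rw [hψ, ← hu, u.inv_mul])⟩, rfl⟩

lemma isUnit_toConv_unopMap {ψ : H →ₐ[k] Bᵐᵒᵖ} (hψ : IsUnit (T.map (unopMap ψ))) :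
    IsUnit (toConv (unopMap ψ)) := by
  obtain ⟨u, hu⟩ := hψ
  have hrel (s) (hs : s ∈ S) : SatisfiesRel s ((↑u⁻¹⁻¹ : Matrix ι ι B).map MulOpposite.op) := by
    rw [inv_inv, hu]
    exact (hT.satisfiesRel s hs).map ψ
  obtain ⟨φ, hφ⟩ := hT.exists_lift (↑u⁻¹ : Matrix ι ι B) fun s hs =>
    (satisfiesRel_map_op_inv_iff s u⁻¹).1 (hrel s hs)
  exact ⟨⟨_, _, hT.conv_unop_mul_eq_one (by rw [hφ, ← hu, u.mul_inv]),
    hT.conv_mul_unop_eq_one (by rw [hφ, ← hu, u.inv_mul])⟩, rfl⟩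

end IsPresentation

end Presentation

section Projections

variable {k H A : Type*} [CommRing k] [Ring H] [Bialgebra k H] [Ring A] [Algebra k A]

variable (k H) in
/-- `a ⊗ b ↦ ε(b) a`. -/
def homFst : H ⊗[k] H →ₗc[k] H :=
  (Coalgebra.TensorProduct.rid k k H).toCoalgHom.comp
    (Coalgebra.TensorProduct.map (.id k H) (Coalgebra.counitCoalgHom k H))

variable (k H) in
/-- `a ⊗ b ↦ ε(a) b`. -/
def homSnd : H ⊗[k] H →ₗc[k] H :=
  (homFst k H).comp (swapHom k H)

@[simp] lemma homFst_tmul (a b : H) : homFst k H (a ⊗ₜ b) = counit (R := k) b • a := rfl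

@[simp] lemma homSnd_tmul (a b : H) : homSnd k H (a ⊗ₜ b) = counit (R := k) a • b := rfl

lemma pull_homFst_mul_pull_homSnd_tmul (f g : WithConv (H →ₗ[k] A)) (a b : H) :
    (pull (homFst k H) f * pull (homSnd k H) g) (a ⊗ₜ b) = f a * g b := by
  rw [convMul_tmul _ _ (ℛ k a) (ℛ k b), ← sum_counit_left_smul (ℛ k b) g.ofConv,
    ← sum_counit_right_smul (ℛ k a) f.ofConv, Finset.sum_mul_sum]
  simp [smul_smul, mul_comm]

lemma pull_homSnd_mul_pull_homFst_tmul (f g : WithConv (H →ₗ[k] A)) (a b : H) :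
    (pull (homSnd k H) g * pull (homFst k H) f) (a ⊗ₜ b) = g b * f a := by
  have h : pull (swapHom k H) (pull (homFst k H) g * pull (homSnd k H) f) =
      pull (homSnd k H) g * pull (homFst k H) f := by
    rw [map_mul]
    congr 1
    ext a b
    simp
  rw [← h]
  exact pull_homFst_mul_pull_homSnd_tmul g f b a

end Projections

section LegMatrices

variable {ι K : Type*} [Fintype ι] [DecidableEq ι] [CommRing K]

variable (ι K) in
/-- `A ↦ A₁₂ = A ⊗ 1`. -/
def matrix12 : Matrix (ι × ι) (ι × ι) K →ₐ[K] Matrix ((ι × ι) × ι) ((ι × ι) × ι) K :=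
  kronLeft K K (ι × ι) ι

variable (ι K) in
/-- `A ↦ A₂₃ = 1 ⊗ A`. -/
def matrix23 : Matrix (ι × ι) (ι × ι) K →ₐ[K] Matrix ((ι × ι) × ι) ((ι × ι) × ι) K :=
  (Matrix.reindexAlgEquiv K K (Equiv.prodAssoc ι ι ι).symm).toAlgHom.comp (kronRight K K ι (ι × ι))

lemma matrix12_apply (A : Matrix (ι × ι) (ι × ι) K) (i j l p q r : ι) :
    matrix12 ι K A ((i, j), l) ((p, q), r) = if l = r then A (i, j) (p, q) else 0 := by
  simp [matrix12, kronLeft_apply]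

lemma matrix23_apply (A : Matrix (ι × ι) (ι × ι) K) (i j l p q r : ι) :
    matrix23 ι K A ((i, j), l) ((p, q), r) = if i = p then A (j, l) (q, r) else 0 := by
  simp [matrix23, kronRight_apply]

lemma matrix12_mul_matrix23_apply (A D : Matrix (ι × ι) (ι × ι) K) (i j l p q r : ι) :
    (matrix12 ι K A * matrix23 ι K D) ((i, j), l) ((p, q), r) =
      ∑ m, A (i, j) (p, m) * D (m, l) (q, r) := by
  simp [Matrix.mul_apply, Fintype.sum_prod_type, matrix12_apply, matrix23_apply]

lemma matrix23_mul_matrix12_apply (A D : Matrix (ι × ι) (ι × ι) K) (i j l p q r : ι) :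
    (matrix23 ι K A * matrix12 ι K D) ((i, j), l) ((p, q), r) =
      ∑ m, A (j, l) (m, r) * D (i, m) (p, q) := by
  simp [Matrix.mul_apply, Fintype.sum_prod_type, matrix12_apply, matrix23_apply]

lemma matrix12_mul_apply (A : Matrix (ι × ι) (ι × ι) K)
    (M : Matrix ((ι × ι) × ι) ((ι × ι) × ι) K) (i j l : ι) (z : (ι × ι) × ι) :
    (matrix12 ι K A * M) ((i, j), l) z = ∑ m, ∑ n, A (i, j) (m, n) * M ((m, n), l) z := by
  simp [Matrix.mul_apply, Fintype.sum_prod_type, matrix12_apply]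

lemma matrix23_mul_apply (A : Matrix (ι × ι) (ι × ι) K)
    (M : Matrix ((ι × ι) × ι) ((ι × ι) × ι) K) (i j l : ι) (z : (ι × ι) × ι) :
    (matrix23 ι K A * M) ((i, j), l) z = ∑ m, ∑ n, A (j, l) (m, n) * M ((i, m), n) z := by
  simp [Matrix.mul_apply, Fintype.sum_prod_type, matrix23_apply]

lemma mul_matrix12_apply (M : Matrix ((ι × ι) × ι) ((ι × ι) × ι) K)
    (A : Matrix (ι × ι) (ι × ι) K) (z : (ι × ι) × ι) (p q r : ι) :
    (M * matrix12 ι K A) z ((p, q), r) = ∑ m, ∑ n, M z ((m, n), r) * A (m, n) (p, q) := by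
  simp [Matrix.mul_apply, Fintype.sum_prod_type, matrix12_apply]

lemma mul_matrix23_apply (M : Matrix ((ι × ι) × ι) ((ι × ι) × ι) K)
    (A : Matrix (ι × ι) (ι × ι) K) (z : (ι × ι) × ι) (p q r : ι) :
    (M * matrix23 ι K A) z ((p, q), r) = ∑ m, ∑ n, M z ((p, m), n) * A (m, n) (q, r) := by
  simp [Matrix.mul_apply, Fintype.sum_prod_type, matrix23_apply]

end LegMatrices

section Blocks

variable {k ι K : Type*}

/-- The matrices `(C_{(j,i),(p,q)})_{j,q}`, indexed by `i` and `p`. -/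
def blocks (C : Matrix (ι × ι) (ι × ι) K) : Matrix ι ι (Matrix ι ι K) :=
  .of fun i p => .of fun j q => C (j, i) (p, q)

@[simp] lemma blocks_apply (C : Matrix (ι × ι) (ι × ι) K) (i j p q : ι) :
    blocks C i p j q = C (j, i) (p, q) := rfl

variable [Field k] [Fintype ι] [DecidableEq ι] [CommRing K] [Algebra k K]
  {s : ι → ι → ι → ι → k} {C : Matrix (ι × ι) (ι × ι) K}

lemma isUnit_blocks (hC : IsUnit C) : IsUnit (blocks C) := by
  have hswap : IsUnit (C.submatrix (Equiv.prodComm ι ι) (Equiv.refl (ι × ι))) :=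
    (Matrix.isUnit_submatrix_equiv _ _).2 hC
  exact hswap.map (Matrix.compRingEquiv ι ι K).symm

lemma satisfiesRel_blocks
    (h : SemiconjBy (matrix12 ι K C * matrix23 ι K C) (matrix12 ι K (relMatrix K s))
      (matrix23 ι K (relMatrix K s))) : SatisfiesRel s (blocks C) := by
  intro i j p q
  ext a b
  have hentry := congrFun₂ h.eq ((a, i), j) ((p, q), b)
  rw [mul_matrix12_apply, matrix23_mul_apply] at hentry
  simp only [matrix12_mul_matrix23_apply] at hentry
  simp only [rel, Matrix.sub_apply, Matrix.sum_apply, Matrix.smul_apply, Matrix.mul_apply,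
    blocks_apply, Matrix.zero_apply, sub_eq_zero]
  simpa only [relMatrix, Matrix.of_apply, mul_comm _ (algebraMap k K _), ← Algebra.smul_def]
    using hentry.symm

end Blocks

section TensorSquare

variable {k ι H K : Type*} [CommRing k] [Fintype ι] [DecidableEq ι] [Ring H] [Bialgebra k H]
  [CommRing K] [Algebra k K] {T : Matrix ι ι H}

/-- The tensor square `x ↦ ρ(x₂) ⊗ ρ(x₁)` of a representation, for the opposite coproduct. -/
def tensorSquare (ρ : H →ₐ[k] Matrix ι ι K) : H →ₐ[k] Matrix (ι × ι) (ι × ι) K :=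
  convHom ((kronRight k K ι ι).comp ρ) ((kronLeft k K ι ι).comp ρ) fun _ _ =>
    (commute_kronLeft_kronRight fun _ _ _ _ => Commute.all _ _).symm

lemma tensorSquare_apply (ρ : H →ₐ[k] Matrix ι ι K) {κ : Type*} {x : H} (r : Repr k x κ)
    (u v : ι × ι) : tensorSquare ρ x u v =
      ∑ i ∈ r.index, ρ (r.left i) u.2 v.2 * ρ (r.right i) u.1 v.1 := by
  have h : tensorSquare ρ x = ∑ i ∈ r.index,
      kronRight k K ι ι (ρ (r.left i)) * kronLeft k K ι ι (ρ (r.right i)) := convHom_apply _ _ _ r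
  rw [h]
  simp only [Matrix.sum_apply, kronRight_mul_kronLeft_apply]

lemma kronRight_mul_kronLeft_convEntries_apply (ρ : H →ₐ[k] Matrix ι ι K) (u v : ι × ι) (x : H) :
    (kronRight k _ ι ι (convEntries (toConv ρ.toLinearMap)) *
      kronLeft k _ ι ι (convEntries (toConv ρ.toLinearMap))) u v x = tensorSquare ρ x u v := by
  rw [kronRight_mul_kronLeft_apply, (ℛ k x).convMul_apply, tensorSquare_apply _ (ℛ k x)]
  rfl

lemma IsComatrix.tensorSquare_apply (hT : IsComatrix k T) {C : Matrix (ι × ι) (ι × ι) K}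
    {ρ : H →ₐ[k] Matrix ι ι K}
    (hρ : T.map ρ = blocks C) (a b i j p q : ι) : tensorSquare ρ (T a b) (i, j) (p, q) =
      (matrix23 ι K C * matrix12 ι K C) ((i, j), a) ((b, p), q) := by
  have hρT (i p : ι) : ρ (T i p) = blocks C i p := congrFun₂ hρ i p
  rw [matrix23_mul_matrix12_apply, InfFRT.tensorSquare_apply _ (hT.repr a b)]
  simp [hρT]

lemma IsGeneratingComatrix.antiHom_apply_mul (hT : IsGeneratingComatrix k T)
    {ψ : H →ₐ[k] (WithConv (H →ₗ[k] K))ᵐᵒᵖ}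
    (h : ∀ i j a b, unopMap ψ (T i j) (a * b) =
      ∑ m, unopMap ψ (T i m) a * unopMap ψ (T m j) b)
    {κ : Type*} {c : H} (r : Repr k c κ) (a b : H) :
    unopMap ψ c (a * b) =
      ∑ l ∈ r.index, unopMap ψ (r.left l) a * unopMap ψ (r.right l) b := by
  let φ₁ := (AlgHom.op (pull (A := K) (homFst k H))).comp ψ
  let φ₂ := (AlgHom.op (pull (A := K) (homSnd k H))).comp ψ
  have happ (x y a b : H) :
      (φ₁ x * φ₂ y).unop (a ⊗ₜ b) = unopMap ψ x a * unopMap ψ y b :=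
    (pull_homSnd_mul_pull_homFst_tmul (unopMap ψ x) (unopMap ψ y) a b).trans (mul_comm _ _)
  have hφ (x y : H) : Commute (φ₁ x) (φ₂ y) := MulOpposite.unop_injective <| bilin_ext fun a b =>
    (happ x y a b).trans (pull_homFst_mul_pull_homSnd_tmul (unopMap ψ x) (unopMap ψ y) a b).symm
  have heq : (AlgHom.op (pull (A := K) (Bialgebra.mulCoalgHom k H))).comp ψ =
      convHom φ₁ φ₂ hφ := hT.algHom_ext fun i j => MulOpposite.unop_injective <|
    bilin_ext fun a b => (h i j a b).trans (by
      simp only [convHom_apply _ _ _ (hT.repr i j), Finset.unop_sum, ofConv_sum,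
        LinearMap.sum_apply, happ, IsComatrix.repr_index, IsComatrix.repr_left,
        IsComatrix.repr_right])
  have hc := congrArg (fun χ => (χ c).unop (a ⊗ₜ b)) heq
  simp only [convHom_apply _ _ _ r, Finset.unop_sum, ofConv_sum, LinearMap.sum_apply,
    happ] at hc
  exact hc

end TensorSquare

section Existence

variable {k ι H K : Type*} [Field k] [Fintype ι] [DecidableEq ι] [Ring H] [Bialgebra k H]
  [CommRing K] [Algebra k K] {T : Matrix ι ι H} {s : ι → ι → ι → ι → k}
  {C : Matrix (ι × ι) (ι × ι) K}

lemma IsGeneratingComatrix.satisfiesRel_op_convEntries (hT : IsGeneratingComatrix k T)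
    (h : SemiconjBy (matrix23 ι K C * matrix12 ι K C) (matrix23 ι K (relMatrix K s))
      (matrix12 ι K (relMatrix K s)))
    {ρ : H →ₐ[k] Matrix ι ι K} (hρ : T.map ρ = blocks C) :
    SatisfiesRel s ((convEntries (toConv ρ.toLinearMap)).map MulOpposite.op) := by
  have hgen (a b : ι) : Commute (relMatrix K s) (tensorSquare ρ (T a b)) := by
    ext ⟨i, j⟩ ⟨p, q⟩
    have hentry := congrFun₂ h.eq ((i, j), a) ((b, p), q)
    rw [mul_matrix23_apply, matrix12_mul_apply] at hentry
    simpa only [Matrix.mul_apply, Fintype.sum_prod_type, hT.tensorSquare_apply hρ] using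
      hentry.symm
  rw [satisfiesRel_map_op_iff]
  ext ⟨i, j⟩ ⟨p, q⟩ x
  have hx := congrFun₂ (hT.semiconjBy hgen x).eq (i, j) (p, q)
  rw [relMatrix_mul_apply, mul_relMatrix_apply] at hx ⊢
  simpa [kronRight_mul_kronLeft_convEntries_apply] using hx

theorem IsPresentation.exists_isBicharacter {S : Set (ι → ι → ι → ι → k)}
    (hT : IsPresentation S T) (hC : IsUnit C)
    (h₁ : ∀ s ∈ S, SemiconjBy (matrix12 ι K C * matrix23 ι K C)
      (matrix12 ι K (relMatrix K s)) (matrix23 ι K (relMatrix K s)))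
    (h₂ : ∀ s ∈ S, SemiconjBy (matrix23 ι K C * matrix12 ι K C)
      (matrix23 ι K (relMatrix K s)) (matrix12 ι K (relMatrix K s))) :
    ∃ f : WithConv (H ⊗[k] H →ₗ[k] K), IsUnit f ∧ IsBicharacter f ∧
      ∀ i j p q, f (T i p ⊗ₜ T j q) = C (j, i) (p, q) := by
  obtain ⟨ρ, hρ⟩ := hT.exists_lift (blocks C) fun s hs => satisfiesRel_blocks (h₁ s hs)
  have hρ_unit : IsUnit (toConv ρ.toLinearMap) := hT.isUnit_toConv (hρ ▸ isUnit_blocks hC)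
  obtain ⟨ψ, hψ⟩ := hT.exists_antiLift (convEntries (toConv ρ.toLinearMap)) fun s hs =>
    hT.satisfiesRel_op_convEntries (h₂ s hs) hρ
  have hψ_unit : IsUnit (toConv (unopMap ψ)) :=
    hT.isUnit_toConv_unopMap (hψ ▸ hρ_unit.map convEntries)
  have hψ_gen (j q : ι) (a : H) : unopMap ψ (T j q) a = ρ a j q :=
    congrArg (fun g : WithConv (H →ₗ[k] K) => g a) (congrFun₂ hψ j q)
  let f : WithConv (H ⊗[k] H →ₗ[k] K) :=
    pull (swapHom k H) ((convCurry k H K).symm (toConv (unopMap ψ)))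
  have hf (a b : H) : f (a ⊗ₜ b) = unopMap ψ b a := rfl
  have hf_unit : IsUnit f := (hψ_unit.map (convCurry k H K).symm).map (pull (swapHom k H))
  refine ⟨f, hf_unit, isBicharacter_of_isUnit hf_unit (fun a b => ?_) (fun b c => ?_), ?_⟩
  · ext c
    rw [(ℛ k c).convMul_apply]
    refine hT.antiHom_apply_mul (fun i j a b => ?_) (ℛ k c) a b
    simp only [hψ_gen, map_mul, Matrix.mul_apply]
  · exact congrArg MulOpposite.unop (map_mul ψ b c)
  · intro i j p q
    rw [hf, hψ_gen]
    exact congrFun₂ (congrFun₂ hρ i p) j q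

end Existence

section Uniqueness

variable {k ι H A : Type*} [CommRing k] [Fintype ι] [DecidableEq ι] [Ring H] [Bialgebra k H]
  [Ring A] [Algebra k A] {T : Matrix ι ι H}

/-- The matrix representation `a ↦ (f(a ⊗ T_j^q))_{j,q}` attached to a bicharacter. -/
def IsBicharacter.matrixHom {f : WithConv (H ⊗[k] H →ₗ[k] A)} (hf : IsBicharacter f)
    (hT : IsComatrix k T) : H →ₐ[k] Matrix ι ι A :=
  hT.evalHom.comp hf.left

@[simp] lemma IsBicharacter.matrixHom_apply {f : WithConv (H ⊗[k] H →ₗ[k] A)}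
    (hf : IsBicharacter f) (hT : IsComatrix k T) (a : H) (j q : ι) :
    hf.matrixHom hT a j q = f (a ⊗ₜ T j q) := rfl

theorem IsGeneratingComatrix.bicharacter_ext (hT : IsGeneratingComatrix k T)
    {f g : WithConv (H ⊗[k] H →ₗ[k] A)} (hf : IsBicharacter f) (hg : IsBicharacter g)
    (h : ∀ i j p q, f (T i p ⊗ₜ T j q) = g (T i p ⊗ₜ T j q)) : f = g := by
  have hmatrix : hf.matrixHom hT.toIsComatrix = hg.matrixHom hT.toIsComatrix :=
    hT.algHom_ext fun i p => by ext j q; exact h i j p q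
  have hright : hf.right = hg.right := hT.algHom_ext fun j q => MulOpposite.unop_injective <| by
    ext a
    exact congrArg (fun φ => φ a j q) hmatrix
  exact bilin_ext fun a b => congrArg (fun φ => (φ b).unop a) hright

end Uniqueness

section Interchange

variable {k ι H K : Type*} [CommRing k] [Ring H] [Bialgebra k H] [CommRing K] [Algebra k K]

variable (k H K) in
/-- `H → K ⊗ H`, as an element of the convolution algebra. -/
def inclRight : WithConv (H →ₗ[k] K ⊗[k] H) :=
  toConv (Algebra.TensorProduct.includeRight : H →ₐ[k] K ⊗[k] H).toLinearMap

lemma conv_mul_convConst_mul_apply {B : Type*} [Ring B] [Algebra k B] (f g : WithConv (H →ₗ[k] B))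
    (X : B) {κ : Type*} {x : H} (r : Repr k x κ) :
    (f * convConst k H X * g) x = ∑ i ∈ r.index, f (r.left i) * X * g (r.right i) := by
  rw [r.convMul_apply]
  exact Finset.sum_congr rfl fun i _ => congrArg (· * _) (mul_convConst_apply f X (r.left i))

lemma push_mul_inclRight_mul_convConst_apply (g : WithConv (H →ₗ[k] K)) (b : H) {κ : Type*}
    {a : H} (r : Repr k a κ) :
    (push (Algebra.TensorProduct.includeLeft : K →ₐ[k] K ⊗[k] H) g * inclRight k H K *
      convConst k H ((1 : K) ⊗ₜ[k] b)) a =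
      ∑ i ∈ r.index, g (r.left i) ⊗ₜ[k] (r.right i * b) := by
  rw [mul_convConst_apply, r.convMul_apply, Finset.sum_mul]
  simp [inclRight]

lemma convConst_mul_inclRight_mul_push_apply (b : H) (g : WithConv (H →ₗ[k] K)) {κ : Type*}
    {a : H} (r : Repr k a κ) :
    (convConst k H ((1 : K) ⊗ₜ[k] b) * inclRight k H K *
      push (Algebra.TensorProduct.includeLeft : K →ₐ[k] K ⊗[k] H) g) a =
      ∑ i ∈ r.index, g (r.right i) ⊗ₜ[k] (b * r.left i) := by
  rw [mul_assoc, convConst_mul_apply, r.convMul_apply, Finset.mul_sum]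
  simp [inclRight]

variable [Fintype ι] [DecidableEq ι] {T : Matrix ι ι H}

lemma IsGeneratingComatrix.conv_unopMap_mul_convConst_mul {B : Type*} [Ring B] [Algebra k B]
    (hT : IsGeneratingComatrix k T) {φ : H →ₐ[k] Bᵐᵒᵖ} {ψ : H →ₐ[k] B}
    (hφψ : ∀ x y, Commute (unopMap φ x) (ψ y)) {X : B}
    (h : T.map (toConv (unopMap φ) * convConst k H X * toConv ψ.toLinearMap) =
      T.map (toConv ψ.toLinearMap * convConst k H X * toConv (unopMap φ))) :
    toConv (unopMap φ) * convConst k H X * toConv ψ.toLinearMap =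
      toConv ψ.toLinearMap * convConst k H X * toConv (unopMap φ) := by
  ext x
  induction x using hT.induction with
  | gen i j => exact congrFun₂ h i j
  | algebraMap r => simp [Algebra.TensorProduct.one_def, Algebra.algebraMap_eq_smul_one]
  | add a b ha hb => rw [map_add, map_add, ha, hb]
  | mul a b ha hb =>
    rw [conv_mul_convConst_mul_apply _ _ X (ℛ k a), conv_mul_convConst_mul_apply _ _ X (ℛ k a)]
      at ha
    rw [conv_mul_convConst_mul_apply _ _ X (ℛ k b), conv_mul_convConst_mul_apply _ _ X (ℛ k b)]
      at hb
    rw [conv_mul_convConst_mul_apply _ _ X ((ℛ k a).mul (ℛ k b)),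
      conv_mul_convConst_mul_apply _ _ X ((ℛ k a).mul (ℛ k b))]
    simp only [Repr.mul_index, Repr.mul_left, Repr.mul_right, AlgHom.toLinearMap_apply,
      unopMap_apply, map_mul, MulOpposite.unop_mul, Finset.sum_product] at ha hb hφψ ⊢
    calc _ = ∑ j ∈ (ℛ k b).index, (φ ((ℛ k b).left j)).unop *
          (∑ i ∈ (ℛ k a).index, (φ ((ℛ k a).left i)).unop * X * ψ ((ℛ k a).right i)) *
          ψ ((ℛ k b).right j) := by
          rw [Finset.sum_comm]
          simp only [Finset.mul_sum, Finset.sum_mul, mul_assoc]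
      _ = ∑ i ∈ (ℛ k a).index, ψ ((ℛ k a).left i) *
          (∑ j ∈ (ℛ k b).index, (φ ((ℛ k b).left j)).unop * X * ψ ((ℛ k b).right j)) *
          (φ ((ℛ k a).right i)).unop := by
          rw [ha]
          simp only [Finset.mul_sum, Finset.sum_mul, mul_assoc, (hφψ _ _).eq, (hφψ _ _).left_comm]
          rw [Finset.sum_comm]
      _ = _ := by
          rw [hb]
          simp only [Finset.mul_sum, Finset.sum_mul, mul_assoc]

variable {f : WithConv (H ⊗[k] H →ₗ[k] K)} {C : Matrix (ι × ι) (ι × ι) K}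

lemma IsBicharacter.sum_tmul_mul_gen (hf : IsBicharacter f) (hT : IsGeneratingComatrix k T)
    (hfC : ∀ i j p q, f (T i p ⊗ₜ T j q) = C (j, i) (p, q))
    (hC : Commute (C.map fun x => x ⊗ₜ[k] (1 : H))
      (kronLeft k (K ⊗[k] H) ι ι (T.map fun h => 1 ⊗ₜ h) *
        kronRight k (K ⊗[k] H) ι ι (T.map fun h => 1 ⊗ₜ h)))
    {κ : Type*} {a : H} (r : Repr k a κ) (j q : ι) :
    ∑ i ∈ r.index, ∑ n, f (r.left i ⊗ₜ T j n) ⊗ₜ[k] (r.right i * T n q) =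
      ∑ i ∈ r.index, ∑ n, f (r.right i ⊗ₜ T n q) ⊗ₜ[k] (T j n * r.left i) := by
  let φ : H →ₐ[k] Matrix ι ι (K ⊗[k] H) :=
    (Algebra.TensorProduct.includeLeft : K →ₐ[k] K ⊗[k] H).mapMatrix.comp
      (hf.matrixHom hT.toIsComatrix)
  let ψ : H →ₐ[k] Matrix ι ι (K ⊗[k] H) :=
    (Matrix.scalarAlgHom ι k).comp Algebra.TensorProduct.includeRight
  let N : Matrix ι ι (K ⊗[k] H) := T.map fun h => 1 ⊗ₜ h
  have hφψ (x y : H) : Commute (φ x) (ψ y) := by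
    ext j q
    simp [φ, ψ]
  have hl (x y : H) (j q : ι) :
      (φ x * ψ y * N) j q = ∑ n, f (x ⊗ₜ T j n) ⊗ₜ[k] (y * T n q) := by
    simp [Matrix.mul_apply (N := N), φ, ψ, N]
  have hr (x y : H) (j q : ι) :
      (N * (ψ x * φ y)) j q = ∑ n, f (y ⊗ₜ T n q) ⊗ₜ[k] (T j n * x) := by
    simp [Matrix.mul_apply (M := N), φ, ψ, N]
  have hgen (i p : ι) : SemiconjBy N (convHom ψ φ (fun x y => (hφψ y x).symm) (T i p))
      (convHom φ ψ hφψ (T i p)) := by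
    ext j q
    have h := congrFun₂ hC.eq (j, i) (p, q)
    rw [convHom_apply _ _ _ (hT.repr i p), convHom_apply _ _ _ (hT.repr i p), Finset.sum_mul,
      Finset.mul_sum, Matrix.sum_apply, Matrix.sum_apply]
    simp only [hl, hr, hT.repr_index, hT.repr_left, hT.repr_right, hfC]
    simp only [Matrix.mul_apply (M := C.map _), Matrix.mul_apply (N := C.map _),
      Fintype.sum_prod_type, kronLeft_mul_kronRight_apply] at h
    rw [Finset.sum_comm]
    simpa using h.symm
  have h := congrFun₂ (hT.semiconjBy hgen a).eq j q
  rw [convHom_apply _ _ _ r, convHom_apply _ _ _ r, Finset.sum_mul, Finset.mul_sum,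
    Matrix.sum_apply, Matrix.sum_apply] at h
  simpa only [hl, hr] using h.symm

end Interchange

section QuasiCommutative

variable {k ι H K : Type*} [Field k] [Ring H] [Bialgebra k H] [CommRing K] [Algebra k K]

/-- `f(a₁ ⊗ b₁) ⊗ a₂ b₂ = f(a₂ ⊗ b₂) ⊗ b₁ a₁` in `K ⊗ H`, for a form with values in `K`. -/
def IsQuasiCommutative (f : WithConv (H ⊗[k] H →ₗ[k] K)) : Prop :=
  push Algebra.TensorProduct.includeLeft f *
      push (Algebra.TensorProduct.includeRight : H →ₐ[k] K ⊗[k] H) (convMult k H) =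
    push (Algebra.TensorProduct.includeRight : H →ₐ[k] K ⊗[k] H) (convMultOp k H) *
      push Algebra.TensorProduct.includeLeft f

lemma IsQuasiCommutative.unitForm_mul {f : WithConv (H ⊗[k] H →ₗ[k] K)}
    (hf : IsQuasiCommutative f) (l : K →ₗ[k] k) :
    unitForm (toConv (l ∘ₗ f.ofConv)) * convMult k H =
      convMultOp k H * unitForm (toConv (l ∘ₗ f.ofConv)) := by
  refine bilin_ext fun a b => ?_
  have h := congrArg (fun g : WithConv (H ⊗[k] H →ₗ[k] K ⊗[k] H) =>
    TensorProduct.lid k H (TensorProduct.map l LinearMap.id (g (a ⊗ₜ b)))) hf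
  simp only [convMul_tmul _ _ (ℛ k a) (ℛ k b), map_sum] at h ⊢
  simpa [unitForm, convMult, convMultOp, Algebra.algebraMap_eq_smul_one] using h

theorem IsBicharacter.isQuasiCommutative [Fintype ι] [DecidableEq ι] {T : Matrix ι ι H}
    {f : WithConv (H ⊗[k] H →ₗ[k] K)} {C : Matrix (ι × ι) (ι × ι) K}
    (hf : IsBicharacter f) (hT : IsGeneratingComatrix k T)
    (hfC : ∀ i j p q, f (T i p ⊗ₜ T j q) = C (j, i) (p, q))
    (hC : Commute (C.map fun x => x ⊗ₜ[k] (1 : H))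
      (kronLeft k (K ⊗[k] H) ι ι (T.map fun h => 1 ⊗ₜ h) *
        kronRight k (K ⊗[k] H) ι ι (T.map fun h => 1 ⊗ₜ h))) :
    IsQuasiCommutative f := by
  let φ : H →ₐ[k] (WithConv (H →ₗ[k] K ⊗[k] H))ᵐᵒᵖ :=
    (push (Algebra.TensorProduct.includeLeft : K →ₐ[k] K ⊗[k] H)).op.comp hf.right
  let ψ : H →ₐ[k] WithConv (H →ₗ[k] K ⊗[k] H) :=
    (convConst k H).comp Algebra.TensorProduct.includeRight
  have hφψ (x y : H) : Commute (unopMap φ x) (ψ y) := by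
    ext a
    refine (mul_convConst_apply _ _ a).trans (Eq.trans ?_ (convConst_mul_apply _ _ a).symm)
    simp [φ]
  have h := hT.conv_unopMap_mul_convConst_mul hφψ (X := inclRight k H K) <| by
    ext j q a
    simp only [Matrix.map_apply, conv_mul_convConst_mul_apply _ _ _ (hT.repr j q), ofConv_sum,
      LinearMap.sum_apply, hT.repr_index, hT.repr_left, hT.repr_right]
    refine (Finset.sum_congr rfl fun n _ =>
      push_mul_inclRight_mul_convConst_apply (legR f (T j n)) (T n q) (ℛ k a)).trans <|
      Eq.trans ?_ (Finset.sum_congr rfl fun n _ =>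
      convConst_mul_inclRight_mul_push_apply (T j n) (legR f (T n q)) (ℛ k a)).symm
    rw [Finset.sum_comm, Finset.sum_comm (s := Finset.univ)]
    exact hf.sum_tmul_mul_gen hT hfC hC (ℛ k a) j q
  refine bilin_ext fun a b => ?_
  have hab := congrArg (fun g : WithConv (H →ₗ[k] WithConv (H →ₗ[k] K ⊗[k] H)) => g b a) h
  simp only [conv_mul_convConst_mul_apply _ _ _ (ℛ k b), ofConv_sum, LinearMap.sum_apply] at hab
  rw [convMul_tmul _ _ (ℛ k a) (ℛ k b), convMul_tmul _ _ (ℛ k a) (ℛ k b), Finset.sum_comm,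
    Finset.sum_comm (s := (ℛ k a).index)]
  refine Eq.trans (Finset.sum_congr rfl fun i _ => ?_) <| hab.trans <|
    Finset.sum_congr rfl fun i _ => ?_
  · refine Eq.trans ?_ (push_mul_inclRight_mul_convConst_apply (legR f _) _ (ℛ k a)).symm
    simp [convMult]
  · refine (convConst_mul_inclRight_mul_push_apply _ (legR f _) (ℛ k a)).trans ?_
    simp [convMultOp]

end QuasiCommutative

section LegRelations

/-- `(1 + e t₂₃) c₂₃ (1 + e t₁₂) c₁₂ = (1 + e (t₂₃ + c₂₃ t₁₂ c₂₃⁻¹)) c₂₃ c₁₂` when `e² = 0`. -/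
lemma semiconjBy_deform {K A : Type*} [CommRing K] [Ring A] [Algebra K A] {e : K}
    {c₁₂ c₂₃ : Aˣ} {t₁₂ t₂₃ x y : A} (he : e * e = 0) (hc : SemiconjBy (c₂₃ * c₁₂ : A) x y)
    (ht : Commute (t₂₃ + c₂₃ * t₁₂ * ↑c₂₃⁻¹) y) :
    SemiconjBy (((1 + e • t₂₃) * c₂₃) * ((1 + e • t₁₂) * c₁₂)) x y := by
  have hprod : ((1 + e • t₂₃) * c₂₃) * ((1 + e • t₁₂) * c₁₂) =
      (1 + e • (t₂₃ + c₂₃ * t₁₂ * ↑c₂₃⁻¹)) * (c₂₃ * c₁₂) := by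
    have hmove : (c₂₃ * (1 + e • t₁₂) : A) = (1 + e • (c₂₃ * t₁₂ * ↑c₂₃⁻¹)) * c₂₃ := by
      simp [mul_add, add_mul, mul_assoc]
    rw [mul_assoc, ← mul_assoc (c₂₃ : A), hmove, mul_assoc _ (c₂₃ : A), ← mul_assoc]
    simp only [mul_add, add_mul, mul_one, one_mul, smul_mul_smul_comm, he, zero_smul, add_zero,
      smul_add, add_assoc]
  rw [hprod]
  exact SemiconjBy.mul_left ((Commute.one_left y).add_left (ht.smul_left e)) hc

/-- The relations between the legs `c₁₂, c₂₃, t₁₂, t₂₃` of an infinitesimally braided vector space,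
for elements of an arbitrary ring. -/
structure LegRelations {A : Type*} [Ring A] (c₁₂ c₂₃ : Aˣ) (t₁₂ t₂₃ : A) : Prop where
  braid : (c₁₂ * c₂₃ * c₁₂ : A) = c₂₃ * c₁₂ * c₂₃
  conj₁ : c₂₃ * t₁₂ * ↑c₂₃⁻¹ = ↑c₁₂⁻¹ * t₂₃ * c₁₂
  conj₂ : ↑c₁₂⁻¹ * t₂₃ * c₁₂ = ↑c₂₃⁻¹ * t₁₂ * c₂₃
  conj₃ : ↑c₂₃⁻¹ * t₁₂ * c₂₃ = c₁₂ * t₂₃ * ↑c₁₂⁻¹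
  comm₁ : Commute (t₁₂ + c₁₂ * t₂₃ * ↑c₁₂⁻¹) t₂₃
  comm₂ : Commute (t₂₃ + c₂₃ * t₁₂ * ↑c₂₃⁻¹) t₁₂

namespace LegRelations

variable {A : Type*} [Ring A] {c₁₂ c₂₃ : Aˣ} {t₁₂ t₂₃ : A}

lemma symm (h : LegRelations c₁₂ c₂₃ t₁₂ t₂₃) : LegRelations c₂₃ c₁₂ t₂₃ t₁₂ where
  braid := h.braid.symm
  conj₁ := h.conj₃.symm
  conj₂ := h.conj₂.symm
  conj₃ := h.conj₁.symm
  comm₁ := h.comm₂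
  comm₂ := h.comm₁

lemma semiconjBy_braiding (h : LegRelations c₁₂ c₂₃ t₁₂ t₂₃) :
    SemiconjBy (c₂₃ * c₁₂ : A) c₂₃ c₁₂ :=
  h.braid.symm.trans (mul_assoc ..)

lemma semiconjBy_infinitesimal (h : LegRelations c₁₂ c₂₃ t₁₂ t₂₃) :
    SemiconjBy (c₂₃ * c₁₂ : A) t₂₃ t₁₂ := by
  refine SemiconjBy.mul_left (y := c₁₂ * t₂₃ * ↑c₁₂⁻¹) ?_ ?_
  · rw [← h.conj₃]
    simp [SemiconjBy, mul_assoc]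
  · simp [SemiconjBy, mul_assoc]

lemma commute_braiding (h : LegRelations c₁₂ c₂₃ t₁₂ t₂₃) :
    Commute (t₂₃ + c₂₃ * t₁₂ * ↑c₂₃⁻¹) c₁₂ := by
  have h₁ : t₂₃ * c₁₂ = c₁₂ * (c₂₃ * t₁₂ * ↑c₂₃⁻¹) := by simp [h.conj₁, mul_assoc]
  have h₂ : c₂₃ * t₁₂ * ↑c₂₃⁻¹ * c₁₂ = c₁₂ * t₂₃ := by
    simp [h.conj₁, h.conj₂, h.conj₃, mul_assoc]
  rw [commute_iff_eq, add_mul, mul_add, h₁, h₂, add_comm]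

end LegRelations

end LegRelations

section RowMatrix

variable {k n W : Type*} [CommRing k] [AddCommGroup W] [Module k W] [Fintype n] [DecidableEq n]
  (K : Type*) [CommRing K] [Algebra k K]

/-- The matrix of an endomorphism with rows indexed by the source, which makes it an
antihomomorphism; the entries are taken in the `k`-algebra `K`. -/
def rowMatrix (b : Module.Basis n k W) : Module.End k W →ₐ[k] (Matrix n n K)ᵐᵒᵖ :=
  (Matrix.transposeAlgEquiv n k K).toAlgHom.comp <|
    (Algebra.ofId k K).mapMatrix.comp (LinearMap.toMatrixAlgEquiv b).toAlgHom

lemma unop_rowMatrix_apply (b : Module.Basis n k W) (f : Module.End k W) (x y : n) :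
    (rowMatrix K b f).unop x y = algebraMap k K (b.repr (f (b x)) y) := by
  simp [rowMatrix, LinearMap.toMatrixAlgEquiv_apply, Algebra.ofId_apply]

end RowMatrix

section BraidMatrices

variable {k V ι : Type*} [Field k] [AddCommGroup V] [Module k V] [Fintype ι] [DecidableEq ι]
  (K : Type*) [CommRing K] [Algebra k K]

variable (b : Module.Basis ι k V) (f : Module.End k (V ⊗[k] V))

lemma rowMatrix_eq_op_relMatrix :
    rowMatrix K (b.tensorProduct b) f = .op (relMatrix K (coeff b f)) := by
  refine MulOpposite.unop_injective ?_
  ext ⟨i, j⟩ ⟨p, q⟩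
  simp [unop_rowMatrix_apply, relMatrix, coeff]

lemma rowMatrix_leg12 : rowMatrix K ((b.tensorProduct b).tensorProduct b) (leg12 f) =
    (matrix12 ι K).op (rowMatrix K (b.tensorProduct b) f) := by
  refine MulOpposite.unop_injective ?_
  ext ⟨⟨i, j⟩, l⟩ ⟨⟨p, q⟩, r⟩
  rw [unop_rowMatrix_apply, AlgHom.op_apply_apply, MulOpposite.unop_op, matrix12_apply,
    unop_rowMatrix_apply]
  simp [leg12, Finsupp.single_apply, apply_ite (algebraMap k K)]

lemma rowMatrix_leg23 : rowMatrix K ((b.tensorProduct b).tensorProduct b) (leg23 f) =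
    (matrix23 ι K).op (rowMatrix K (b.tensorProduct b) f) := by
  refine MulOpposite.unop_injective ?_
  ext ⟨⟨i, j⟩, l⟩ ⟨⟨p, q⟩, r⟩
  have hassoc (w : V ⊗[k] V) : ((b.tensorProduct b).tensorProduct b).repr
      ((TensorProduct.assoc k V V V).symm (b i ⊗ₜ w)) ((p, q), r) =
        if i = p then (b.tensorProduct b).repr w (q, r) else 0 := by
    induction w using TensorProduct.induction_on with
    | zero => simp
    | tmul x y => simp [Finsupp.single_apply]
    | add x y hx hy =>
      rw [TensorProduct.tmul_add, map_add, map_add, Finsupp.add_apply, hx, hy]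
      split_ifs <;> simp
  rw [unop_rowMatrix_apply, AlgHom.op_apply_apply, MulOpposite.unop_op, matrix23_apply,
    unop_rowMatrix_apply]
  simp [leg23, hassoc, apply_ite (algebraMap k K)]

/-- The unit of `End(V ⊗ V)` attached to `c`, as a matrix with rows indexed by the source. -/
def rowMatrixUnit (c : (V ⊗[k] V) ≃ₗ[k] (V ⊗[k] V)) : ((Matrix (ι × ι) (ι × ι) K)ᵐᵒᵖ)ˣ :=
  Units.map (rowMatrix K (b.tensorProduct b)).toMonoidHom
    (LinearMap.GeneralLinearGroup.ofLinearEquiv c)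

lemma coe_rowMatrixUnit (c : (V ⊗[k] V) ≃ₗ[k] (V ⊗[k] V)) :
    (rowMatrixUnit K b c : (Matrix (ι × ι) (ι × ι) K)ᵐᵒᵖ) =
      .op (relMatrix K (coeff b c.toLinearMap)) :=
  rowMatrix_eq_op_relMatrix K b c.toLinearMap

theorem IsInfinitesimallyBraided.legRelations {c : (V ⊗[k] V) ≃ₗ[k] (V ⊗[k] V)}
    {t : Module.End k (V ⊗[k] V)} (h : IsInfinitesimallyBraided c t) :
    LegRelations (Units.map (matrix12 ι K).op.toMonoidHom (rowMatrixUnit K b c))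
      (Units.map (matrix23 ι K).op.toMonoidHom (rowMatrixUnit K b c))
      ((matrix12 ι K).op (rowMatrix K (b.tensorProduct b) t))
      ((matrix23 ι K).op (rowMatrix K (b.tensorProduct b) t)) := by
  have hmap {f g : Module.End k ((V ⊗[k] V) ⊗[k] V)} (hfg : f = g) :=
    congrArg (rowMatrix K ((b.tensorProduct b).tensorProduct b)) hfg
  have hbraid := hmap h.braid
  have hconj₁ := hmap h.conj₁
  have hconj₂ := hmap h.conj₂
  have hconj₃ := hmap h.conj₃
  have hcomm₁ := hmap h.comm₁
  have hcomm₂ := hmap h.comm₂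
  simp only [map_mul, map_add, rowMatrix_leg12, rowMatrix_leg23]
    at hbraid hconj₁ hconj₂ hconj₃ hcomm₁ hcomm₂
  refine ⟨hbraid, hconj₁, hconj₂, hconj₃, ?_, ?_⟩ <;>
    simp only [commute_iff_eq, add_mul, mul_add, mul_assoc] at hcomm₁ hcomm₂ ⊢
  exacts [hcomm₁, hcomm₂]

end BraidMatrices

section Deformation

variable {k V ι : Type*} [Field k] [AddCommGroup V] [Module k V] [Fintype ι] [DecidableEq ι]
  (b : Module.Basis ι k V) {K : Type*} [CommRing K] [Algebra k K]

/-- The matrix of `(1 + e t) c` with rows indexed by the source. For `e² = 0` it is a first-order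
deformation of the matrix of `c`. -/
def deformedMatrix (e : K) (c t : Module.End k (V ⊗[k] V)) : Matrix (ι × ι) (ι × ι) K :=
  relMatrix K (coeff b c) * (1 + e • relMatrix K (coeff b t))

variable {c : (V ⊗[k] V) ≃ₗ[k] (V ⊗[k] V)} {t : Module.End k (V ⊗[k] V)} {e : K}

lemma isUnit_relMatrix_coeff (c : (V ⊗[k] V) ≃ₗ[k] (V ⊗[k] V)) :
    IsUnit (relMatrix K (coeff b c.toLinearMap)) := by
  have h := (rowMatrixUnit K b c).isUnit.unop
  rwa [coe_rowMatrixUnit] at h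

lemma isUnit_deformedMatrix (he : e * e = 0) :
    IsUnit (deformedMatrix b e c.toLinearMap t) := by
  have hsq : (e • relMatrix K (coeff b t)) ^ 2 = 0 := by
    rw [sq, smul_mul_smul_comm, he, zero_smul]
  exact (isUnit_relMatrix_coeff b c).mul (IsNilpotent.isUnit_one_add ⟨2, hsq⟩)

lemma op_matrix12_deformedMatrix :
    MulOpposite.op (matrix12 ι K (deformedMatrix b e c.toLinearMap t)) =
      (1 + e • (matrix12 ι K).op (rowMatrix K (b.tensorProduct b) t)) *
        ↑(Units.map (matrix12 ι K).op.toMonoidHom (rowMatrixUnit K b c)) := by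
  simp [deformedMatrix, coe_rowMatrixUnit, rowMatrix_eq_op_relMatrix]

lemma op_matrix23_deformedMatrix :
    MulOpposite.op (matrix23 ι K (deformedMatrix b e c.toLinearMap t)) =
      (1 + e • (matrix23 ι K).op (rowMatrix K (b.tensorProduct b) t)) *
        ↑(Units.map (matrix23 ι K).op.toMonoidHom (rowMatrixUnit K b c)) := by
  simp [deformedMatrix, coe_rowMatrixUnit, rowMatrix_eq_op_relMatrix]

variable {s : ι → ι → ι → ι → k} (h : IsInfinitesimallyBraided c t) (he : e * e = 0)
  (hs : s = coeff b c.toLinearMap ∨ s = coeff b t)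
include h he hs

lemma semiconjBy_matrix12_mul_matrix23_deformedMatrix :
    SemiconjBy (matrix12 ι K (deformedMatrix b e c.toLinearMap t) *
        matrix23 ι K (deformedMatrix b e c.toLinearMap t))
      (matrix12 ι K (relMatrix K s)) (matrix23 ι K (relMatrix K s)) := by
  have hleg := h.legRelations K b
  rw [← MulOpposite.semiconjBy_op, MulOpposite.op_mul, op_matrix12_deformedMatrix,
    op_matrix23_deformedMatrix]
  rcases hs with rfl | rfl
  · simpa [coe_rowMatrixUnit] using
      semiconjBy_deform he hleg.semiconjBy_braiding hleg.commute_braiding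
  · simpa [rowMatrix_eq_op_relMatrix] using
      semiconjBy_deform he hleg.semiconjBy_infinitesimal hleg.comm₂

lemma semiconjBy_matrix23_mul_matrix12_deformedMatrix :
    SemiconjBy (matrix23 ι K (deformedMatrix b e c.toLinearMap t) *
        matrix12 ι K (deformedMatrix b e c.toLinearMap t))
      (matrix23 ι K (relMatrix K s)) (matrix12 ι K (relMatrix K s)) := by
  have hleg := (h.legRelations K b).symm
  rw [← MulOpposite.semiconjBy_op, MulOpposite.op_mul, op_matrix12_deformedMatrix,
    op_matrix23_deformedMatrix]
  rcases hs with rfl | rfl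
  · simpa [coe_rowMatrixUnit] using
      semiconjBy_deform he hleg.semiconjBy_braiding hleg.commute_braiding
  · simpa [rowMatrix_eq_op_relMatrix] using
      semiconjBy_deform he hleg.semiconjBy_infinitesimal hleg.comm₂

end Deformation

section DeformedBicharacter

variable {k V ι H K : Type*} [Field k] [AddCommGroup V] [Module k V] [Fintype ι] [DecidableEq ι]
  [Ring H] [Bialgebra k H] [CommRing K] [Algebra k K] (b : Module.Basis ι k V)
  {c : (V ⊗[k] V) ≃ₗ[k] (V ⊗[k] V)} {t : Module.End k (V ⊗[k] V)} {e : K}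

lemma commute_deformedMatrix_map {X : Matrix ι ι (K ⊗[k] H)}
    (hc : SatisfiesRel (coeff b c.toLinearMap) X) (ht : SatisfiesRel (coeff b t) X) :
    Commute ((deformedMatrix b e c.toLinearMap t).map fun x => x ⊗ₜ[k] (1 : H))
      (kronLeft k (K ⊗[k] H) ι ι X * kronRight k (K ⊗[k] H) ι ι X) := by
  let incl := (Algebra.TensorProduct.includeLeft : K →ₐ[K] K ⊗[k] H)
  have hrel (s : ι → ι → ι → ι → k) : incl.mapMatrix (relMatrix K s) = relMatrix (K ⊗[k] H) s := by
    ext x y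
    simp [relMatrix, incl, Algebra.TensorProduct.algebraMap_apply]
  have hmap : (deformedMatrix b e c.toLinearMap t).map (fun x => x ⊗ₜ[k] (1 : H)) =
      relMatrix (K ⊗[k] H) (coeff b c.toLinearMap) *
        (1 + e • relMatrix (K ⊗[k] H) (coeff b t)) := by
    rw [← hrel, ← hrel, ← map_smul, ← map_one incl.mapMatrix, ← map_add, ← map_mul]
    rfl
  rw [hmap]
  exact ((satisfiesRel_iff _ _).1 hc).mul_left <|
    (Commute.one_left _).add_left (((satisfiesRel_iff _ _).1 ht).smul_left e)

theorem IsInfinitesimallyBraided.exists_isBicharacter {T : Matrix ι ι H}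
    {S : Set (ι → ι → ι → ι → k)} (h : IsInfinitesimallyBraided c t) (hT : IsPresentation S T)
    (hS : S ⊆ {coeff b c.toLinearMap, coeff b t}) (hc : SatisfiesRel (coeff b c.toLinearMap) T)
    (ht : SatisfiesRel (coeff b t) T) (he : e * e = 0) :
    ∃ f : WithConv (H ⊗[k] H →ₗ[k] K), IsUnit f ∧ IsBicharacter f ∧ IsQuasiCommutative f ∧
      ∀ i j p q, f (T i p ⊗ₜ T j q) = deformedMatrix b e c.toLinearMap t (j, i) (p, q) := by
  obtain ⟨f, hf_unit, hf, hf_gen⟩ := hT.exists_isBicharacter (isUnit_deformedMatrix b he)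
    (fun s hs => semiconjBy_matrix12_mul_matrix23_deformedMatrix b h he (hS hs))
    (fun s hs => semiconjBy_matrix23_mul_matrix12_deformedMatrix b h he (hS hs))
  let incl := (Algebra.TensorProduct.includeRight : H →ₐ[k] K ⊗[k] H)
  exact ⟨f, hf_unit, hf, hf.isQuasiCommutative hT.toIsGeneratingComatrix hf_gen
    (commute_deformedMatrix_map b (hc.map incl) (ht.map incl)), hf_gen⟩

end DeformedBicharacter

section DualNumber

variable {k C : Type*} [CommRing k] [AddCommGroup C] [Module k C] [Coalgebra k C]

variable (k C) in
/-- A form with values in the dual numbers is a dual number `f + ε g` over the convolution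
algebra. -/
def dualConv : WithConv (C →ₗ[k] DualNumber k) ≃+* DualNumber (WithConv (C →ₗ[k] k)) where
  toFun f := .inl (push (TrivSqZeroExt.fstHom k k k) f) +
    .inr (toConv (TrivSqZeroExt.sndHom k k ∘ₗ f.ofConv))
  invFun f := toConv ((TrivSqZeroExt.inlAlgHom k k k).toLinearMap ∘ₗ f.fst.ofConv +
    TrivSqZeroExt.inrHom k k ∘ₗ f.snd.ofConv)
  left_inv f := by ext x <;> simp
  right_inv f := by
    refine TrivSqZeroExt.ext ?_ ?_ <;> ext x <;> simp
  map_add' f g := by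
    refine TrivSqZeroExt.ext ?_ ?_ <;> ext x <;> simp
  map_mul' f g := by
    refine TrivSqZeroExt.ext (by simp) ?_
    ext x
    simp only [TrivSqZeroExt.snd_add, TrivSqZeroExt.snd_inl, TrivSqZeroExt.snd_inr, zero_add,
      DualNumber.snd_mul, TrivSqZeroExt.fst_add, TrivSqZeroExt.fst_inl, TrivSqZeroExt.fst_inr,
      add_zero, ofConv_add, LinearMap.add_apply, (ℛ k x).convMul_apply]
    simp [(ℛ k x).convMul_apply, Finset.sum_add_distrib]

@[simp] lemma fst_dualConv (f : WithConv (C →ₗ[k] DualNumber k)) :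
    (dualConv k C f).fst = push (TrivSqZeroExt.fstHom k k k) f := by
  simp [dualConv]

@[simp] lemma snd_dualConv_apply (f : WithConv (C →ₗ[k] DualNumber k)) (x : C) :
    (dualConv k C f).snd x = (f x).snd := by
  simp [dualConv]

@[simp] lemma dualConv_symm_apply (f : DualNumber (WithConv (C →ₗ[k] k))) (x : C) :
    (dualConv k C).symm f x = .inl (f.fst x) + .inr (f.snd x) := rfl

end DualNumber

section Deform

variable {k H : Type*} [CommRing k] [Ring H] [Bialgebra k H]

/-- The first-order deformation `R(1 + ε χ)` of `R` along `χ`. -/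
def deform (R χ : WithConv (H ⊗[k] H →ₗ[k] k)) : WithConv (H ⊗[k] H →ₗ[k] DualNumber k) :=
  (dualConv k (H ⊗[k] H)).symm (.inl R + .inr (R * χ))

variable {R χ : WithConv (H ⊗[k] H →ₗ[k] k)}

lemma isUnit_deform (hR : IsUnit R) : IsUnit (deform R χ) :=
  .map _ (TrivSqZeroExt.isUnit_iff_isUnit_fst.2 (by simpa using hR))

lemma eq_deform {u : (WithConv (H ⊗[k] H →ₗ[k] k))ˣ} {f : WithConv (H ⊗[k] H →ₗ[k] DualNumber k)}
    (h : push (TrivSqZeroExt.fstHom k k k) f = u) :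
    f = deform u.val (u⁻¹.val * (dualConv k _ f).snd) := by
  rw [deform, RingEquiv.eq_symm_apply]
  exact TrivSqZeroExt.ext (by simp [h]) (by simp)

lemma fst_deform_apply (x : H ⊗[k] H) : (deform R χ x).fst = R x := by simp [deform]

lemma snd_deform_apply (x : H ⊗[k] H) : (deform R χ x).snd = (R * χ) x := by
  simp [deform]

lemma dualConv_legL_deform (a : H) :
    dualConv k H (legL (deform R χ) a) = .inl (legL R a) + .inr (legL (R * χ) a) := by
  refine TrivSqZeroExt.ext ?_ ?_ <;> ext b <;>
    simp [snd_dualConv_apply, fst_deform_apply, snd_deform_apply]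

lemma dualConv_legR_deform (b : H) :
    dualConv k H (legR (deform R χ) b) = .inl (legR R b) + .inr (legR (R * χ) b) := by
  refine TrivSqZeroExt.ext ?_ ?_ <;> ext a <;>
    simp [snd_dualConv_apply, fst_deform_apply, snd_deform_apply]

lemma legL_deform_mul_iff (hR : ∀ a b, legL R (a * b) = legL R a * legL R b) (a b : H) :
    legL (deform R χ) (a * b) = legL (deform R χ) a * legL (deform R χ) b ↔
      legL (R * χ) (a * b) = legL R a * legL (R * χ) b + legL (R * χ) a * legL R b := by
  rw [← (dualConv k H).injective.eq_iff, map_mul (dualConv k H), TrivSqZeroExt.ext_iff]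
  simp only [dualConv_legL_deform]
  simp [hR]

lemma legR_deform_mul_iff (hR : ∀ b c, legR R (b * c) = legR R c * legR R b) (b c : H) :
    legR (deform R χ) (b * c) = legR (deform R χ) c * legR (deform R χ) b ↔
      legR (R * χ) (b * c) = legR R c * legR (R * χ) b + legR (R * χ) c * legR R b := by
  rw [← (dualConv k H).injective.eq_iff, map_mul (dualConv k H), TrivSqZeroExt.ext_iff]
  simp only [dualConv_legR_deform]
  simp [hR]

end Deform

section Infinitesimal

lemma mul_units_mul_eq_add_iff {A : Type*} [Ring A] (u v : Aˣ) (x y z : A) :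
    u * v * x = u * (v * y) + u * z * v ↔ x = y + ↑v⁻¹ * z * v := by
  have h : (u * v * (y + ↑v⁻¹ * z * v) : A) = u * (v * y) + u * z * v := by
    simp [mul_add, mul_assoc]
  rw [← h, ← Units.val_mul, Units.mul_right_inj]

variable {k H : Type*} [Field k] [Ring H] [Bialgebra k H]

lemma formMulLeft_eq_add_iff (f g : ConvForm k H) :
    formMulLeft g = form13 f * form23 g + form13 g * form23 f ↔
      ∀ a b, legL g (a * b) = legL f a * legL g b + legL g a * legL f b := by
  refine ⟨fun h a b => ?_, fun h => trilin_ext fun a b c => ?_⟩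
  · ext c
    rw [ofConv_add, LinearMap.add_apply, ← form13_mul_form23_apply, ← form13_mul_form23_apply,
      ← formMulLeft_apply, h]
    rfl
  · rw [ofConv_add, LinearMap.add_apply, form13_mul_form23_apply, form13_mul_form23_apply,
      formMulLeft_apply, h]
    rfl

lemma formMulRight_eq_add_iff (f g : ConvForm k H) :
    formMulRight g = form13 f * form12 g + form13 g * form12 f ↔
      ∀ b c, legR g (b * c) = legR f c * legR g b + legR g c * legR f b := by
  refine ⟨fun h b c => ?_, fun h => trilin_ext fun a b c => ?_⟩
  · ext a
    rw [ofConv_add, LinearMap.add_apply, ← form13_mul_form12_apply, ← form13_mul_form12_apply,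
      ← formMulRight_apply, h]
    rfl
  · rw [ofConv_add, LinearMap.add_apply, form13_mul_form12_apply, form13_mul_form12_apply,
      formMulRight_apply, h]
    rfl

lemma formMulLeft_mul (f g : ConvForm k H) :
    formMulLeft (f * g) = formMulLeft f * formMulLeft g :=
  map_mul (pull (Coalgebra.TensorProduct.map (Bialgebra.mulCoalgHom k H) (.id k H))) f g

lemma formMulRight_mul (f g : ConvForm k H) :
    formMulRight (f * g) = formMulRight f * formMulRight g :=
  map_mul (pull ((Coalgebra.TensorProduct.map (.id k H) (Bialgebra.mulCoalgHom k H)).comp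
    (Coalgebra.TensorProduct.assoc k k H H H).toCoalgHom)) f g

lemma unitForm_eq_push (f : ConvForm k H) : unitForm f = push (Algebra.ofId k H) f := rfl

variable {R : (ConvForm k H)ˣ}

lemma IsBicharacter.isCoquasitriangular (hR : IsBicharacter R.val)
    (hq : IsQuasiCommutative R.val) : IsCoquasitriangular R where
  quasi_comm := hq.unitForm_mul LinearMap.id
  mul_right := (formMulRight_eq_iff _).2 hR.mul_right
  mul_left := (formMulLeft_eq_iff _).2 hR.mul_left

namespace IsCoquasitriangular

variable (hR : IsCoquasitriangular R) {χ : ConvForm k H}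
include hR

lemma legL_deform_mul_iff : (∀ a b, legL (deform R.val χ) (a * b) =
      legL (deform R.val χ) a * legL (deform R.val χ) b) ↔
    formMulLeft χ = form23 χ + form23 R⁻¹.val * form13 χ * form23 R.val := by
  simp only [InfFRT.legL_deform_mul_iff hR.isBicharacter.mul_left, ← formMulLeft_eq_add_iff,
    formMulLeft_mul, hR.mul_left, form13_eq_pull, form23_eq_pull, map_mul]
  exact mul_units_mul_eq_add_iff (Units.map (pull (hom13 k H)).toMonoidHom R)
    (Units.map (pull (hom23 k H)).toMonoidHom R) _ _ _

lemma legR_deform_mul_iff : (∀ b c, legR (deform R.val χ) (b * c) =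
      legR (deform R.val χ) c * legR (deform R.val χ) b) ↔
    formMulRight χ = form12 χ + form12 R⁻¹.val * form13 χ * form12 R.val := by
  simp only [InfFRT.legR_deform_mul_iff hR.isBicharacter.mul_right, ← formMulRight_eq_add_iff,
    formMulRight_mul, hR.mul_right, form13_eq_pull, form12_eq_pull, map_mul]
  exact mul_units_mul_eq_add_iff (Units.map (pull (hom13 k H)).toMonoidHom R)
    (Units.map (pull (hom12 k H)).toMonoidHom R) _ _ _

theorem isInfinitesimalRForm (hf : IsBicharacter (deform R.val χ))
    (hq : IsQuasiCommutative (deform R.val χ)) : IsInfinitesimalRForm R χ := by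
  refine ⟨?_, hR.legR_deform_mul_iff.1 hf.mul_right, hR.legL_deform_mul_iff.1 hf.mul_left⟩
  have hsnd : toConv (TrivSqZeroExt.sndHom k k ∘ₗ (deform R.val χ).ofConv) = R.val * χ :=
    bilin_ext fun a b => snd_deform_apply (a ⊗ₜ b)
  have hRχ := hq.unitForm_mul (TrivSqZeroExt.sndHom k k)
  rw [hsnd] at hRχ
  have hR_comm := hR.quasi_comm
  simp only [unitForm_eq_push, map_mul] at hRχ hR_comm ⊢
  rw [← (R.isUnit.map (push (Algebra.ofId k H))).mul_right_inj, ← mul_assoc, hRχ, ← mul_assoc,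
    ← hR_comm, mul_assoc]

end IsCoquasitriangular

theorem IsInfinitesimalRForm.isBicharacter {χ : ConvForm k H} (hχ : IsInfinitesimalRForm R χ)
    (hR : IsCoquasitriangular R) : IsBicharacter (deform R.val χ) :=
  isBicharacter_of_isUnit (isUnit_deform R.isUnit) (hR.legL_deform_mul_iff.2 hχ.mul_left)
    (hR.legR_deform_mul_iff.2 hχ.mul_right)

end Infinitesimal

section Values

variable {k ι κ C D H A B : Type*} [CommRing k] [Fintype ι] [DecidableEq ι] [Fintype κ]
  [DecidableEq κ] [AddCommGroup C] [Module k C] [Coalgebra k C] [AddCommGroup D] [Module k D]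
  [Coalgebra k D]
  [Ring H] [Bialgebra k H] [Ring A] [Algebra k A] [Ring B] [Algebra k B]

lemma IsComatrix.map {T : Matrix ι ι C} (hT : IsComatrix k T) (φ : C →ₗc[k] D) :
    IsComatrix k (T.map φ) where
  comul i j := by
    rw [Matrix.map_apply, ← CoalgHomClass.map_comp_comul_apply, hT.comul, map_sum]
    rfl
  counit i j := by rw [Matrix.map_apply, CoalgHomClass.counit_comp_apply, hT.counit]

lemma IsComatrix.kroneckerTMul {T : Matrix ι ι C} {T' : Matrix κ κ D} (hT : IsComatrix k T)
    (hT' : IsComatrix k T') : IsComatrix k (T ⊗ₖₜ[k] T') where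
  comul := by
    rintro ⟨i, j⟩ ⟨p, q⟩
    simp only [Matrix.kroneckerTMul_apply, TensorProduct.comul_tmul, hT.comul, hT'.comul,
      TensorProduct.sum_tmul, TensorProduct.tmul_sum, map_sum, Fintype.sum_prod_type,
      TensorProduct.AlgebraTensorModule.tensorTensorTensorComm_tmul]
    exact Finset.sum_comm
  counit := by
    rintro ⟨i, j⟩ ⟨p, q⟩
    simp [hT.counit, hT'.counit, Prod.ext_iff, ite_and]

lemma IsBicharacter.push {f : WithConv (H ⊗[k] H →ₗ[k] A)} (hf : IsBicharacter f)
    (φ : A →ₐ[k] B) : IsBicharacter (InfFRT.push φ f) := by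
  have hl (a : H) : legL (InfFRT.push φ f) a = InfFRT.push φ (legL f a) := rfl
  have hr (a : H) : legR (InfFRT.push φ f) a = InfFRT.push φ (legR f a) := rfl
  constructor
  · intro a b
    rw [hl, hl, hl, hf.mul_left, map_mul]
  · intro a b
    rw [hr, hr, hr, hf.mul_right, map_mul]
  · rw [hl, hf.one_left, map_one]
  · rw [hr, hf.one_right, map_one]

lemma IsBicharacter.pull {H' : Type*} [Ring H'] [Bialgebra k H']
    {f : WithConv (H' ⊗[k] H' →ₗ[k] A)} (hf : IsBicharacter f) (φ : H →ₐc[k] H') :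
    IsBicharacter (InfFRT.pull
      (Coalgebra.TensorProduct.map (φ : H →ₗc[k] H') (φ : H →ₗc[k] H')) f) := by
  set g := InfFRT.pull (Coalgebra.TensorProduct.map (φ : H →ₗc[k] H') (φ : H →ₗc[k] H')) f
  have hl (a : H) : legL g a = InfFRT.pull (φ : H →ₗc[k] H') (legL f (φ a)) := rfl
  have hr (a : H) : legR g a = InfFRT.pull (φ : H →ₗc[k] H') (legR f (φ a)) := rfl
  constructor
  · intro a b
    rw [hl, hl, hl, map_mul φ, hf.mul_left, map_mul]
  · intro a b
    rw [hr, hr, hr, map_mul φ, hf.mul_right, map_mul]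
  · rw [hl, map_one φ, hf.one_left, map_one]
  · rw [hr, map_one φ, hf.one_right, map_one]

end Values

section Uniqueness

variable {k ι H : Type*} [Field k] [Fintype ι] [DecidableEq ι] [Ring H] [Bialgebra k H]

theorem IsGeneratingComatrix.infinitesimalRForm_ext {T : Matrix ι ι H}
    (hT : IsGeneratingComatrix k T) {R : (ConvForm k H)ˣ} (hR : IsCoquasitriangular R)
    {χ χ' : ConvForm k H} (hχ : IsInfinitesimalRForm R χ) (hχ' : IsInfinitesimalRForm R χ')
    (h : ∀ i j p q, χ (T i p ⊗ₜ T j q) = χ' (T i p ⊗ₜ T j q)) : χ = χ' := by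
  let eval := (hT.kroneckerTMul hT.toIsComatrix).evalHom (A := k)
  have heval : eval χ = eval χ' := by
    ext x y
    exact h x.1 x.2 y.1 y.2
  have hmul : eval (R.val * χ) = eval (R.val * χ') := by rw [map_mul, map_mul, heval]
  have hdeform : deform R.val χ = deform R.val χ' :=
    hT.bicharacter_ext (hχ.isBicharacter hR) (hχ'.isBicharacter hR) fun i j p q =>
      TrivSqZeroExt.ext (by rw [fst_deform_apply, fst_deform_apply]) <| by
        rw [snd_deform_apply, snd_deform_apply]
        exact congrFun₂ hmul (i, j) (p, q)
  refine R.mul_right_inj.1 (bilin_ext fun x y => ?_)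
  rw [← snd_deform_apply, ← snd_deform_apply, hdeform]

end Uniqueness

section Presentations

variable {k V ι : Type*} [Field k] [AddCommGroup V] [Module k V] [Fintype ι] [DecidableEq ι]

lemma isPresentation_genF : IsPresentation (k := k) ∅ (genF (ι := ι) k) where
  comul := comul_genF
  counit := counit_genF
  adjoin_eq_top := FreeAlgebra.adjoin_range_ι k (ι × ι)
  satisfiesRel _ hs := hs.elim
  ker_le x hx := by
    have hid : liftF (genF k) = AlgHom.id k (F k ι) := algHomF_ext (liftF_genF (genF k))
    rw [hid, AlgHom.id_apply] at hx
    exact hx ▸ zero_mem _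

variable {H H' : Type*} [Ring H] [Bialgebra k H] [Ring H'] [Bialgebra k H']
  {S : Set (ι → ι → ι → ι → k)} {s : ι → ι → ι → ι → k} {T : Matrix ι ι H}

lemma IsPresentation.mem_span_of_liftF_mem_relIdeal (hT : IsPresentation S T) {x : F k ι}
    (hx : liftF (k := k) T x ∈ relIdeal s T) : x ∈ TwoSidedIdeal.span
      {x : F k ι | ∃ r ∈ insert s S, ∃ i j p q, x = rel r (genF k) i j p q} := by
  set J := TwoSidedIdeal.span
    {x : F k ι | ∃ r ∈ insert s S, ∃ i j p q, x = rel r (genF k) i j p q}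
  let π := Ideal.Quotient.mkₐ k J.asIdeal
  let X : Matrix ι ι (F k ι ⧸ J.asIdeal) := Matrix.map (genF k) π
  have hX (r) (hr : r ∈ insert s S) : SatisfiesRel r X := fun i j p q =>
    (map_rel r (genF k) π i j p q).symm.trans <| Ideal.Quotient.eq_zero_iff_mem.2 <|
      TwoSidedIdeal.mem_asIdeal.2 (TwoSidedIdeal.subset_span ⟨r, hr, i, j, p, q, rfl⟩)
  obtain ⟨φ, hφ⟩ := hT.exists_lift X fun r hr => hX r (Or.inr hr)
  have hφx : φ (liftF T x) = 0 := relIdeal_le_ker s T φ (fun i j p q =>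
    (map_rel s T φ i j p q).trans <| by
      change rel s (T.map φ) i j p q = 0
      rw [hφ]
      exact hX s (Or.inl rfl) i j p q) hx
  have hcomp : φ.comp (liftF T) = π := algHomF_ext fun i j =>
    (congrArg φ (liftF_genF T i j)).trans (congrFun₂ hφ i j)
  rw [← AlgHom.comp_apply, hcomp] at hφx
  exact TwoSidedIdeal.mem_asIdeal.1 (Ideal.Quotient.eq_zero_iff_mem.1 hφx)

lemma IsPresentation.map (hT : IsPresentation S T) (φ : H →ₐc[k] H')
    (hφ : Function.Surjective φ) (hker : ∀ x, φ x = 0 ↔ x ∈ relIdeal s T) :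
    IsPresentation (insert s S) (T.map φ) := by
  have hlift : liftF (k := k) (T.map φ) = (φ : H →ₐ[k] H').comp (liftF T) :=
    algHomF_ext fun i j =>
      (liftF_genF (T.map φ) i j).trans (congrArg φ (liftF_genF T i j)).symm
  refine ⟨⟨hT.toIsComatrix.map (φ : H →ₗc[k] H'), ?_⟩, ?_,
    fun x hx => hT.mem_span_of_liftF_mem_relIdeal ((hker _).1 ?_)⟩
  · refine (Algebra.adjoin_range_eq_range_freeAlgebra_lift k _ _).trans ?_
    change (liftF (k := k) (T.map φ)).range = ⊤
    rw [AlgHom.range_eq_top, hlift]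
    exact hφ.comp hT.surjective_liftF
  · rintro r (rfl | hr)
    · intro i j p q
      exact (map_rel r T (φ : H →ₐ[k] H') i j p q).symm.trans
        ((hker _).2 (rel_mem r T i j p q))
    · exact (hT.satisfiesRel r hr).map (φ : H →ₐ[k] H')
  · rw [hlift] at hx
    exact hx

variable (b : Module.Basis ι k V) (c t : Module.End k (V ⊗[k] V))

lemma isPresentation_genFRT : IsPresentation {coeff b c} (genFRT b c) := by
  rw [← insert_empty_eq]
  exact isPresentation_genF.map (Bialgebra.Quotient.mkBialgHom (relIdeal (coeff b c) (genF k)))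
    Ideal.Quotient.mk_surjective fun _ => Ideal.Quotient.eq_zero_iff_mem

lemma isPresentation_genInfFRT : IsPresentation {coeff b t, coeff b c} (genInfFRT b c t) :=
  (isPresentation_genFRT b c).map (proj b c t) Ideal.Quotient.mk_surjective
    fun _ => Ideal.Quotient.eq_zero_iff_mem

end Presentations

section Existence

variable {k V ι H : Type*} [Field k] [AddCommGroup V] [Module k V] [Fintype ι] [DecidableEq ι]
  [Ring H] [Bialgebra k H] (b : Module.Basis ι k V) {c : (V ⊗[k] V) ≃ₗ[k] (V ⊗[k] V)}
  {t : Module.End k (V ⊗[k] V)} {T : Matrix ι ι H} {S : Set (ι → ι → ι → ι → k)}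

lemma fst_deformedMatrix_eps (i j p q : ι) :
    (deformedMatrix b (DualNumber.eps (R := k)) c.toLinearMap t (i, j) (p, q)).fst =
      coeff b c.toLinearMap i j p q := by
  rw [deformedMatrix, mul_add, mul_one]
  simp [relMatrix, Matrix.mul_apply, TrivSqZeroExt.algebraMap_eq_inl,
    TrivSqZeroExt.fst_sum]

lemma snd_deformedMatrix_eps (i j : ι) (x : ι × ι) :
    (deformedMatrix b (DualNumber.eps (R := k)) c.toLinearMap t (i, j) x).snd =
      (relMatrix k (coeff b c.toLinearMap) * relMatrix k (coeff b t)) (i, j) x := by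
  rw [deformedMatrix, mul_add, mul_one]
  simp [relMatrix, Matrix.mul_apply, TrivSqZeroExt.algebraMap_eq_inl,
    TrivSqZeroExt.snd_sum]

theorem IsInfinitesimallyBraided.exists_isCoquasitriangular (h : IsInfinitesimallyBraided c t)
    (hT : IsPresentation S T) (hS : S ⊆ {coeff b c.toLinearMap, coeff b t})
    (hc : SatisfiesRel (coeff b c.toLinearMap) T) (ht : SatisfiesRel (coeff b t) T) :
    ∃ R : (ConvForm k H)ˣ, IsCoquasitriangular R ∧
      ∀ i j p q, R.val (T i p ⊗ₜ T j q) = coeff b c.toLinearMap j i p q := by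
  obtain ⟨_, ⟨R, rfl⟩, hR, hq, hR_gen⟩ := h.exists_isBicharacter b hT hS hc ht (mul_zero (0 : k))
  refine ⟨R, hR.isCoquasitriangular hq, fun i j p q => ?_⟩
  rw [hR_gen, deformedMatrix, zero_smul, add_zero, mul_one]
  rfl

theorem IsInfinitesimallyBraided.exists_isInfinitesimalRForm (h : IsInfinitesimallyBraided c t)
    (hT : IsPresentation S T) (hS : S ⊆ {coeff b c.toLinearMap, coeff b t})
    (hc : SatisfiesRel (coeff b c.toLinearMap) T) (ht : SatisfiesRel (coeff b t) T)
    {R : (ConvForm k H)ˣ} (hR : IsCoquasitriangular R)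
    (hR_gen : ∀ i j p q, R.val (T i p ⊗ₜ T j q) = coeff b c.toLinearMap j i p q) :
    ∃ χ : ConvForm k H, IsInfinitesimalRForm R χ ∧
      ∀ i j p q, χ (T i p ⊗ₜ T j q) = coeff b t i j p q := by
  obtain ⟨f, -, hf, hq, hf_gen⟩ := h.exists_isBicharacter b hT hS hc ht
    (DualNumber.eps_mul_eps (R := k))
  have hfst : push (TrivSqZeroExt.fstHom k k k) f = R.val :=
    hT.bicharacter_ext (hf.push _) hR.isBicharacter fun i j p q => by
      rw [push_apply, hf_gen, hR_gen]
      exact fst_deformedMatrix_eps b j i p q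
  rw [eq_deform hfst] at hf hq
  refine ⟨_, hR.isInfinitesimalRForm hf hq, fun i j p q => ?_⟩
  let eval := (hT.kroneckerTMul hT.toIsComatrix).evalHom (A := k)
  have hevalR : eval R.val = (relMatrix k (coeff b c.toLinearMap)).submatrix Prod.swap id := by
    ext x y
    exact hR_gen x.1 x.2 y.1 y.2
  have hevalf : eval (dualConv k _ f).snd = eval R.val * relMatrix k (coeff b t) := by
    ext x y
    have hsnd := congrArg TrivSqZeroExt.snd (hf_gen x.1 x.2 y.1 y.2)
    rw [snd_deformedMatrix_eps] at hsnd
    rw [hevalR]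
    exact (snd_dualConv_apply f _).trans hsnd
  have hevalχ : eval (R⁻¹.val * (dualConv k _ f).snd) = relMatrix k (coeff b t) := by
    rw [map_mul, hevalf, ← mul_assoc, ← map_mul, R.inv_mul, map_one, one_mul]
  exact congrFun₂ hevalχ (i, j) (p, q)

lemma IsBraided.isInfinitesimallyBraided_zero (h : IsBraided c) :
    IsInfinitesimallyBraided c 0 := by
  have h12 : leg12 (0 : Module.End k (V ⊗[k] V)) = 0 := by simp [leg12]
  have h23 : leg23 (0 : Module.End k (V ⊗[k] V)) = 0 := by simp [leg23]
  constructor <;> simp [h12, h23, h]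

theorem IsBraided.exists_isFRTStructure (h : IsBraided c) :
    ∃ R, IsFRTStructure b c.toLinearMap R := by
  have hT := isPresentation_genFRT b c.toLinearMap
  obtain ⟨R, hR, hR_gen⟩ := h.isInfinitesimallyBraided_zero.exists_isCoquasitriangular b hT
    (by simp) (hT.satisfiesRel _ rfl) fun i j p q => by simp [rel, coeff]
  exact ⟨R, hR, hR_gen⟩

end Existence

namespace IsFRTStructure

variable {k V ι : Type*} [Field k] [AddCommGroup V] [Module k V] [Fintype ι] [DecidableEq ι]
  {b : Module.Basis ι k V} {c t : Module.End k (V ⊗[k] V)}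
  {R : (ConvForm k (FRTBialgebra b c))ˣ} (hR : IsFRTStructure b c R)
include hR

lemma unique {R' : (ConvForm k (FRTBialgebra b c))ˣ} (hR' : IsFRTStructure b c R') : R = R' :=
  Units.ext <| (isPresentation_genFRT b c).bicharacter_ext hR.coquasitriangular.isBicharacter
    hR'.coquasitriangular.isBicharacter fun i j p q =>
      (hR.gen i j p q).trans (hR'.gen i j p q).symm

lemma descends {R' : (ConvForm k (InfFRTBialgebra b c t))ˣ} (hR' : IsCoquasitriangular R')
    (hR'_gen : ∀ i j p q,
      R'.val (genInfFRT b c t i p ⊗ₜ genInfFRT b c t j q) = coeff b c j i p q) :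
    Descends b c t R R' := by
  have hpull := (isPresentation_genFRT b c).bicharacter_ext
    (hR'.isBicharacter.pull (proj b c t)) hR.coquasitriangular.isBicharacter fun i j p q =>
      (hR'_gen i j p q).trans (hR.gen i j p q).symm
  intro x y
  rw [← hpull]
  rfl

end IsFRTStructure

end InfFRT

end

theorem mainTheorem4 {k V ι : Type*} [Field k] [AddCommGroup V] [Module k V]
    [Fintype ι] [DecidableEq ι] (b : Module.Basis ι k V)
    (c : (V ⊗[k] V) ≃ₗ[k] (V ⊗[k] V)) (t : Module.End k (V ⊗[k] V))
    (h : InfFRT.IsInfinitesimallyBraided c t) :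
    (∃! R : (InfFRT.ConvForm k (InfFRT.FRTBialgebra b c.toLinearMap))ˣ,
      InfFRT.IsFRTStructure b c.toLinearMap R) ∧
    ∀ R : (InfFRT.ConvForm k (InfFRT.FRTBialgebra b c.toLinearMap))ˣ,
      InfFRT.IsFRTStructure b c.toLinearMap R →
      ∃ R' : (InfFRT.ConvForm k (InfFRT.InfFRTBialgebra b c.toLinearMap t))ˣ,
        InfFRT.Descends b c.toLinearMap t R R' ∧ InfFRT.IsCoquasitriangular R' ∧
        ∃! χ : InfFRT.ConvForm k (InfFRT.InfFRTBialgebra b c.toLinearMap t),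
          InfFRT.IsInfinitesimalRForm R' χ ∧
            ∀ i j p q : ι, χ.ofConv
              (InfFRT.genInfFRT b c.toLinearMap t i p ⊗ₜ[k]
                InfFRT.genInfFRT b c.toLinearMap t j q) = InfFRT.coeff b t i j p q := by
  obtain ⟨R₀, hR₀⟩ := h.braid.exists_isFRTStructure b
  refine ⟨⟨R₀, hR₀, fun R hR => hR.unique hR₀⟩, fun R hR => ?_⟩
  have hT := InfFRT.isPresentation_genInfFRT b c.toLinearMap t
  have hS := (Set.pair_comm (InfFRT.coeff b t) (InfFRT.coeff b c.toLinearMap)).subset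
  have hc := hT.satisfiesRel (InfFRT.coeff b c.toLinearMap) (Or.inr rfl)
  have ht := hT.satisfiesRel (InfFRT.coeff b t) (Or.inl rfl)
  obtain ⟨R', hR', hR'_gen⟩ := h.exists_isCoquasitriangular b hT hS hc ht
  obtain ⟨χ, hχ, hχ_gen⟩ := h.exists_isInfinitesimalRForm b hT hS hc ht hR' hR'_gen
  refine ⟨R', hR.descends hR' hR'_gen, hR', χ, ⟨hχ, hχ_gen⟩, fun χ' hχ' => ?_⟩
  exact hT.infinitesimalRForm_ext hR' hχ'.1 hχ fun i j p q =>
    (hχ'.2 i j p q).trans (hχ_gen i j p q).symm
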